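/- Let $\Sigma$ be a finite alphabet with $0,1\in\Sigma$, $0\neq 1$. Let $\Sigma^*$ (finite words) carry the discrete topology and $\Sigma^\omega$ (infinite sequences) the Cantor topology, whose basic open sets are $u\Sigma^\omega$, $u\in\Sigma^*$. A *Type-2 machine* with $k\ge 0$ input tapes is a multi-tape Turing machine with $k$ read-only input tapes (each holding an element of $\Sigma^\omega$), finitely many work tapes and one one-way output tape. With output type $\Sigma^*$ it computes $w$ on input $p$ iff it halts on $p$ with $w$ on the output tape; with output type $\Sigma^\omega$ it computes $q$ on input $p$ iff it computes forever and writes $q$ on the output tape. A partial function $f:\subseteq(\Sigma^\omega)^k\to Y$, $Y\in\{\Sigma^*,\Sigma^\omega\}$, is *computable* iff it has an extension that is exactly the partial function computed by some Type-2 machine. A partial function is *continuous* iff it is continuous on its domain with the subspace topology. A *generalized Turing machine* $N$ on $\Sigma^\omega$ has a finite label set with an initial label $l_0$ and a final label $l_f$, a finite work alphabet $\Gamma$ disjoint from $\Sigma$ and from $\Sigma^\omega$ with a blank symbol $b\in\Gamma$, and numbers $k\le L$. It has tapes $0,\dots,L$, each a two-way infinite sequence of cells indexed by $\mathbb Z$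 with contents in $\Sigma^\omega\cup\Gamma$, and one head on each tape; tape $0$ is the output tape and tapes $1,\dots,k$ are the input tapes. To every label $l\neq l_f$ one statement is assigned, of one of the forms ($x_i$ denotes the content of the cell scanned on tape $i$, and $n\geq 0$): move the head on tape $i$ one cell to the right, or to the left, and go to $l'$; write $a\in\Gamma$ on the scanned cell of tape $i$ and go to $l'$; go to $l'$ if $x_i=a$ and to $l''$ otherwise ($a\in\Gamma$); an assignment "$i:=f(i_1,\dots,i_n)$, go to $l'$" with a multi-function $f$ from $(\Sigma^\omega)^n$ to $\Sigma^\omega$ (write some element of $f(x_{i_1},\dots,x_{i_n})$ on the scanned cell of tape $i$); a test "if $f(i_1,\dots,i_n)$ then $l'$ else $l''$" with a partial function $f:\subseteq(\Sigma^\omega)^n\to\Sigma^*$, $\mathrm{range}(f)\subseteq\{0,1\}$ (go to $l'$ if $f(x_{i_1},\dots,x_{i_n})=0$, to $l''$ if it is $1$). An assignment or a test has no successor configuration if some $x_{i_j}\in\Gamma$ or if $f(x_{i_1},\dots,x_{i_n})$ is empty, respectively undefined. A computation is a finite non-empty or infinite sequence of configurations in which each is a successor of the preceding one; it is maximal if it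 is infinite or its last configuration has no successor; it is accepting if it is finite and its last configuration has label $l_f$ and an element of $\Sigma^\omega$ in cell $0$ of tape $0$, which is its result. The initial configuration for $(p_1,\dots,p_k)\in(\Sigma^\omega)^k$ has label $l_0$, all heads on cell $0$, $p_i$ in cell $0$ of tape $i$ for $1\le i\le k$, and $b$ in all other cells. The multi-function $f_N$ from $(\Sigma^\omega)^k$ to $\Sigma^\omega$ computed by $N$ is defined by: $q\in f_N(p)$ iff every maximal computation from the initial configuration for $p$ is accepting and some accepting computation from it has result $q$. **Theorem.** Let $N$ be a generalized Turing machine on $\Sigma^\omega$. 1. If every function occurring in an assignment of $N$ is a (single-valued) continuous partial function $:\subseteq(\Sigma^\omega)^n\to\Sigma^\omega$ and every function occurring in a test of $N$ is a continuous partial function $:\subseteq(\Sigma^\omega)^n\to\Sigma^*$, then $f_N$ is a (single-valued) continuous partial function $:\subseteq(\Sigma^\omega)^k\to\Sigma^\omega$. 2. If every function occurring in an assignment of $N$ is a (single-valued) computable partial function $:\subseteq(\Sigma^\omega)^n\to\Sigma^\omega$ and every function occurring in a test of $N$ is a computable partial function $:\subseteq(\Sigma^\omega)^n\to\Sigma^*$,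 then $f_N$ is a (single-valued) computable partial function $:\subseteq(\Sigma^\omega)^k\to\Sigma^\omega$. -/

import Mathlib

namespace TTE

universe u v

/-! ## Words, sequences and their topologies -/

/-- Finite words over `A`. -/
def FinWord (A : Type u) : Type u := List A

/-- Infinite sequences over `A`. -/
def OmegaWord (A : Type u) : Type u := ℕ → A

/-- The set of finite words carries the discrete topology. -/
instance instTopologicalSpaceFinWord (A : Type u) : TopologicalSpace (FinWord A) := ⊥

/-- The Cantor topology on infinite sequences: the product of the discrete topologies on `A`;
the cylinders (all extensions of one finite word) form a basis. -/
instance instTopologicalSpaceOmegaWord (A : Type u) : TopologicalSpace (OmegaWord A) :=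
  @Pi.topologicalSpace ℕ (fun _ => A) (fun _ => ⊥)

/-! ## Multi-functions and partial functions -/

/-- A multi-function from `X` to `Y`, given by the set of admissible values at each point. -/
abbrev MultiFun (X : Type u) (Y : Type v) : Type (max u v) := X → Set Y

/-- A partial function, regarded as a multi-function with at most one value at each point. -/
def MultiFun.ofPFun {X : Type u} {Y : Type v} (g : X →. Y) : MultiFun X Y :=
  fun x => {y | y ∈ g x}

/-- A partial function is continuous if it is continuous on its domain, with the subspace
topology. Nothing is required of the domain. -/
def PFunContinuous {X : Type u} {Y : Type v} [TopologicalSpace X] [TopologicalSpace Y]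
    (f : X →. Y) : Prop :=
  Continuous (fun x : f.Dom => f.fn x.1 x.2)

/-- `f` extends `g`, for partial functions. -/
def PFunExtends {X : Type u} {Y : Type v} (f g : X →. Y) : Prop :=
  ∀ x y, y ∈ g x → y ∈ f x

/-! ## Type-2 machines -/

/-- A Type-2 machine with `k` input tapes, each holding an infinite sequence over `A`. There are
`k` read-only input tapes that are infinite to the right, finitely many two-way infinite work
tapes over a finite alphabet whose blank symbol is `default`, and a single one-way write-only
output tape. Depending on the control state and the scanned symbols, the machine either halts
(`none`) or passes to a new control state, moves the input heads, writes on the work tapes and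
then moves their heads, and appends at most one symbol to the output. A head for which the
direction `none` is given stays where it is. -/
structure TypeTwoMachine (A : Type u) (k : ℕ) where
  State : Type
  [finiteState : Finite State]
  start : State
  workTapes : ℕ
  Work : Type
  [inhabitedWork : Inhabited Work]
  [finiteWork : Finite Work]
  next : State → (Fin k → A) → (Fin workTapes → Work) →
    Option (State × (Fin k → Option Turing.Dir) ×
      (Fin workTapes → Work × Option Turing.Dir) × Option A)

namespace TypeTwoMachine

attribute [instance] finiteState inhabitedWork finiteWork

variable {A : Type u} {k : ℕ}

/-- A configuration: the control state, the positions of the input heads, the work tapes, and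
the word on the output tape. -/
structure Config (M : TypeTwoMachine A k) where
  state : M.State
  inputHead : Fin k → ℕ
  work : Fin M.workTapes → Turing.Tape M.Work
  out : List A

/-- The initial configuration: input heads on the first symbol, blank work and output tapes. -/
def init (M : TypeTwoMachine A k) : M.Config where
  state := M.start
  inputHead := fun _ => 0
  work := fun _ => Turing.Tape.mk₁ []
  out := []

/-- The motion of an input head; moving left from the first cell has no effect. -/
def moveInput : Option Turing.Dir → ℕ → ℕ
  | none, n => n
  | some Turing.Dir.left, n => n - 1
  | some Turing.Dir.right, n => n + 1

/-- The action on a work tape: write, then move. -/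
def actWork {W : Type} [Inhabited W] (a : W × Option Turing.Dir) (T : Turing.Tape W) :
    Turing.Tape W :=
  match a.2 with
  | none => T.write a.1
  | some d => (T.write a.1).move d

/-- One step on input `p`; `none` if the machine halts in the configuration `c`. -/
def step (M : TypeTwoMachine A k) (p : Fin k → OmegaWord A) (c : M.Config) : Option M.Config :=
  (M.next c.state (fun i => p i (c.inputHead i)) (fun j => (c.work j).head)).map fun t =>
    { state := t.1
      inputHead := fun i => moveInput (t.2.1 i) (c.inputHead i)
      work := fun j => actWork (t.2.2.1 j) (c.work j)
      out := c.out ++ t.2.2.2.toList }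

/-- The configuration after `n` steps on input `p`; `none` if the machine has halted earlier. -/
def run (M : TypeTwoMachine A k) (p : Fin k → OmegaWord A) : ℕ → Option M.Config
  | 0 => some M.init
  | n + 1 => (M.run p n).bind (M.step p)

/-- On input `p` the machine halts with the word `w` on the output tape. -/
def OutputsWord (M : TypeTwoMachine A k) (p : Fin k → OmegaWord A) (w : FinWord A) : Prop :=
  ∃ (n : ℕ) (c : M.Config), M.run p n = some c ∧ M.step p c = none ∧ c.out = w

/-- On input `p` the machine computes forever and writes the infinite sequence `q` on the output
tape. -/
def OutputsSeq (M : TypeTwoMachine A k) (p : Fin k → OmegaWord A) (q : OmegaWord A) : Prop :=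
  (∀ n : ℕ, ∃ c : M.Config, M.run p n = some c) ∧
    ∀ j : ℕ, ∃ (n : ℕ) (c : M.Config), M.run p n = some c ∧ c.out[j]? = some (q j)

end TypeTwoMachine

/-- `f` is the function computed by some Type-2 machine with output type "finite word". -/
def TuringComputableWord {A : Type u} {k : ℕ} (f : (Fin k → OmegaWord A) →. FinWord A) : Prop :=
  ∃ M : TypeTwoMachine A k, ∀ p w, w ∈ f p ↔ M.OutputsWord p w

/-- `f` is the function computed by some Type-2 machine with output type "infinite sequence". -/
def TuringComputableSeq {A : Type u} {k : ℕ} (f : (Fin k → OmegaWord A) →. OmegaWord A) : Prop :=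
  ∃ M : TypeTwoMachine A k, ∀ p q, q ∈ f p ↔ M.OutputsSeq p q

/-- `f` is computable if it has a Turing computable extension (output type "finite word"). -/
def ComputableWord {A : Type u} {k : ℕ} (f : (Fin k → OmegaWord A) →. FinWord A) : Prop :=
  ∃ g : (Fin k → OmegaWord A) →. FinWord A, TuringComputableWord g ∧ PFunExtends g f

/-- `f` is computable if it has a Turing computable extension (output type "infinite
sequence"). -/
def ComputableSeq {A : Type u} {k : ℕ} (f : (Fin k → OmegaWord A) →. OmegaWord A) : Prop :=
  ∃ g : (Fin k → OmegaWord A) →. OmegaWord A, TuringComputableSeq g ∧ PFunExtends g f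

/-! ## Generalized Turing machines -/

/-- The statements of a generalized Turing machine with tapes `0, …, L`, tape sets `X i`, work
alphabet `Γ` and label set `Lab`. The tests take values in the words `0` and `1` over `A`. -/
inductive Stmt (A : Type u) [Zero A] [One A] {L : ℕ} (X : Fin (L + 1) → Type v) (Γ Lab : Type) :
    Type (max u v) where
  /-- Move the head on tape `i` to the right and go to `l`. -/
  | right (i : Fin (L + 1)) (l : Lab)
  /-- Move the head on tape `i` to the left and go to `l`. -/
  | left (i : Fin (L + 1)) (l : Lab)
  /-- Write `a` on the scanned cell of tape `i` and go to `l`. -/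
  | write (i : Fin (L + 1)) (a : Γ) (l : Lab)
  /-- Go to `l₁` if `a` is scanned on tape `i`, and to `l₂` otherwise. -/
  | ifSymbol (i : Fin (L + 1)) (a : Γ) (l₁ l₂ : Lab)
  /-- The assignment `i := f(i₁, …, iₙ)` for a multi-function `f`; then go to `l`. -/
  | assign (i : Fin (L + 1)) (n : ℕ) (arg : Fin n → Fin (L + 1))
      (f : MultiFun (∀ j, X (arg j)) (X i)) (l : Lab)
  /-- Go to `l₁` if `f(i₁, …, iₙ) = 0`, and to `l₂` if `f(i₁, …, iₙ) = 1`. -/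
  | test (n : ℕ) (arg : Fin n → Fin (L + 1)) (f : (∀ j, X (arg j)) →. FinWord A)
      (range_subset : ∀ x, ∀ w ∈ f x, w = ([0] : List A) ∨ w = ([1] : List A)) (l₁ l₂ : Lab)

/-- A generalized Turing machine with tapes `0, …, L`, of which `0` is the output tape and
`1, …, k` are the input tapes, with tape sets `X i`. -/
structure GTM (A : Type u) [Zero A] [One A] (k L : ℕ) (X : Fin (L + 1) → Type v) where
  Label : Type
  [finiteLabel : Finite Label]
  initial : Label
  final : Label
  Γ : Type
  [finiteΓ : Finite Γ]
  blank : Γ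
  k_le_L : k ≤ L
  stm : {l : Label // l ≠ final} → Stmt A X Γ Label

namespace GTM

attribute [instance] finiteLabel finiteΓ

variable {A : Type u} [Zero A] [One A] {k L : ℕ} {X : Fin (L + 1) → Type v}

/-- The number of the `i`-th input tape (counted from `0`), that is, `i + 1`. -/
def inputTape (M : GTM A k L X) (i : Fin k) : Fin (L + 1) :=
  (Fin.castLE M.k_le_L i).succ

/-- A configuration: the current label, the inscription of each tape, and the head positions.
The disjoint union makes the tape sets disjoint from the work alphabet. -/
structure Config (M : GTM A k L X) where
  label : M.Label
  tape : ∀ i : Fin (L + 1), ℤ → X i ⊕ M.Γ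
  head : Fin (L + 1) → ℤ

/-- The content of the cell scanned on tape `i`. -/
def Config.scanned {M : GTM A k L X} (κ : M.Config) (i : Fin (L + 1)) : X i ⊕ M.Γ :=
  κ.tape i (κ.head i)

/-- Replace the label. -/
def Config.setLabel {M : GTM A k L X} (κ : M.Config) (l : M.Label) : M.Config :=
  { κ with label := l }

/-- Move the head on tape `i` to position `m`. -/
def Config.setHead {M : GTM A k L X} (κ : M.Config) (i : Fin (L + 1)) (m : ℤ) : M.Config :=
  { κ with head := Function.update κ.head i m }

/-- Write `x` under the head of tape `i`. -/
def Config.setCell {M : GTM A k L X} (κ : M.Config) (i : Fin (L + 1)) (x : X i ⊕ M.Γ) :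
    M.Config :=
  { κ with tape := Function.update κ.tape i (Function.update (κ.tape i) (κ.head i) x) }

/-- The effect of a statement: `κ'` is one of the successors of `κ` under it. -/
def Effect (M : GTM A k L X) (κ κ' : M.Config) : Stmt A X M.Γ M.Label → Prop
  | .right i l => κ' = (κ.setHead i (κ.head i + 1)).setLabel l
  | .left i l => κ' = (κ.setHead i (κ.head i - 1)).setLabel l
  | .write i a l => κ' = (κ.setCell i (Sum.inr a)).setLabel l
  | .ifSymbol i a l₁ l₂ =>
      (κ.scanned i = Sum.inr a ∧ κ' = κ.setLabel l₁) ∨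
      (κ.scanned i ≠ Sum.inr a ∧ κ' = κ.setLabel l₂)
  | .assign i _ arg f l =>
      ∃ x : ∀ j, X (arg j), (∀ j, κ.scanned (arg j) = Sum.inl (x j)) ∧
        ∃ y ∈ f x, κ' = (κ.setCell i (Sum.inl y)).setLabel l
  | .test _ arg f _ l₁ l₂ =>
      ∃ x : ∀ j, X (arg j), (∀ j, κ.scanned (arg j) = Sum.inl (x j)) ∧
        ((([0] : List A) ∈ f x ∧ κ' = κ.setLabel l₁) ∨
         (([1] : List A) ∈ f x ∧ κ' = κ.setLabel l₂))

/-- The successor relation on configurations. -/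
def Succ (M : GTM A k L X) (κ κ' : M.Config) : Prop :=
  ∃ h : κ.label ≠ M.final, M.Effect κ κ' (M.stm ⟨κ.label, h⟩)

/-- Finite non-empty and infinite sequences of configurations. -/
inductive ConfigSeq (M : GTM A k L X) where
  | finite (n : ℕ) (κ : Fin (n + 1) → M.Config)
  | infinite (κ : ℕ → M.Config)

/-- The first configuration of a sequence. -/
def ConfigSeq.first {M : GTM A k L X} : M.ConfigSeq → M.Config
  | .finite _ κ => κ 0
  | .infinite κ => κ 0

/-- A computation: each configuration is a successor of the preceding one. -/
def ConfigSeq.IsComputation {M : GTM A k L X} : M.ConfigSeq → Prop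
  | .finite n κ => ∀ i : Fin n, M.Succ (κ i.castSucc) (κ i.succ)
  | .infinite κ => ∀ i : ℕ, M.Succ (κ i) (κ (i + 1))

/-- Maximal: infinite, or the last configuration has no successor. -/
def ConfigSeq.IsMaximal {M : GTM A k L X} : M.ConfigSeq → Prop
  | .finite n κ => ∀ κ' : M.Config, ¬ M.Succ (κ (Fin.last n)) κ'
  | .infinite _ => True

/-- A configuration is accepting if its label is final and cell `0` of tape `0` contains an
element of `X 0`. -/
def Config.IsAccepting {M : GTM A k L X} (κ : M.Config) : Prop :=
  κ.label = M.final ∧ ∃ x : X 0, κ.tape 0 0 = Sum.inl x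

/-- A sequence is accepting if it is finite and its last configuration is accepting. -/
def ConfigSeq.IsAccepting {M : GTM A k L X} : M.ConfigSeq → Prop
  | .finite n κ => (κ (Fin.last n)).IsAccepting
  | .infinite _ => False

/-- The initial configuration: initial label, all heads on position `0`, cell `0` of the `i`-th
input tape contains the `i`-th argument, and all other cells are blank. -/
def initialConfig (M : GTM A k L X) (x : ∀ i : Fin k, X (M.inputTape i)) : M.Config where
  label := M.initial
  tape := Fin.cases (fun _ => Sum.inr M.blank) (fun i j =>
    if h : i.val < k ∧ j = 0 then Sum.inl (x ⟨i.val, h.1⟩) else Sum.inr M.blank)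
  head := fun _ => 0

/-- The multi-function computed by the machine: `y` is a value at `x` if every maximal
computation on `x` is accepting and some accepting computation on `x` has the result `y`. -/
def multiFun (M : GTM A k L X) : MultiFun (∀ i : Fin k, X (M.inputTape i)) (X 0) := fun x =>
  {y | (∀ c : M.ConfigSeq, c.IsComputation → c.first = M.initialConfig x → c.IsMaximal →
          c.IsAccepting) ∧
       ∃ (n : ℕ) (κ : Fin (n + 1) → M.Config),
          (ConfigSeq.finite n κ).IsComputation ∧ κ 0 = M.initialConfig x ∧
          (κ (Fin.last n)).IsAccepting ∧ (κ (Fin.last n)).tape 0 0 = Sum.inl y}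

end GTM

/-! ## Machines on infinite sequences -/

/-- The function that occurs in the statement, if there is one, is a (single-valued, partial)
continuous function. -/
def Stmt.IsContinuous {A : Type u} [Zero A] [One A] {L : ℕ} {Γ Lab : Type} :
    Stmt A (fun _ : Fin (L + 1) => OmegaWord A) Γ Lab → Prop
  | .assign _ n _ f _ =>
      ∃ g : (Fin n → OmegaWord A) →. OmegaWord A, f = MultiFun.ofPFun g ∧ PFunContinuous g
  | .test n _ f _ _ _ => PFunContinuous (X := Fin n → OmegaWord A) f
  | _ => True

/-- The function that occurs in the statement, if there is one, is a (single-valued, partial)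
computable function. -/
def Stmt.IsComputable {A : Type u} [Zero A] [One A] {L : ℕ} {Γ Lab : Type} :
    Stmt A (fun _ : Fin (L + 1) => OmegaWord A) Γ Lab → Prop
  | .assign _ n _ f _ =>
      ∃ g : (Fin n → OmegaWord A) →. OmegaWord A, f = MultiFun.ofPFun g ∧ ComputableSeq g
  | .test n _ f _ _ _ => ComputableWord (k := n) f
  | _ => True

end TTE

/-!
A sequence over `A` enters a finite computation only through its finite prefixes. A (multi-)function
is *realized* by a map `Φ` on finite data when, from a time `t` and prefixes of the arguments, `Φ`
yields a correct prefix of the value, and arbitrarily long ones from large `t` and long prefixes.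
A function is continuous iff it is realized by some `Φ`; a computable function has a primitive
recursive `Φ`, because a Type-2 machine can be simulated for `t` steps on prefixes; and a
function with a primitive recursive `Φ` is computable, because a Type-2 machine can read ever longer
prefixes and evaluate `Φ` on them. So it suffices to simulate a generalized Turing machine for
`t` steps on prefixes, with the realizers of the functions in its statements as subroutines.
-/

namespace TTE

universe u v

/-! ## Primitive recursion on finite types, tuples and integers -/

section Primrec

variable {α β σ : Type*} [Primcodable α] [Primcodable β] [Primcodable σ]

/-- A primitive recursive coding of a finite type, transported from an arbitrary enumeration. -/
noncomputable abbrev primcodableOfFinite (α : Type*) [Finite α] : Primcodable α :=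
  Primcodable.ofEquiv (Fin (Nat.card α)) (Finite.equivFin α)

theorem primrec₂_of_finite [Finite α] {f : α → β → σ} (h : ∀ a, Primrec (f a)) : Primrec₂ f := by
  obtain ⟨n, ⟨e⟩⟩ := Finite.exists_equiv_fin α
  have hf : Primrec₂ fun (i : Fin n) (b : β) => f (e.symm i) b :=
    Primrec.fin_curry₁.2 fun i => h _
  exact (hf.comp ((Primrec.dom_finite e).comp Primrec.fst) Primrec.snd).of_eq fun x => by simp

theorem primrec_pi_mk {n : ℕ} {f : β → Fin n → σ} (h : ∀ j, Primrec fun b => f b j) : Primrec f :=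
  Primrec.fin_curry.2 (primrec₂_of_finite (f := fun j b => f b j) h).swap

theorem primrec_pi_apply {n : ℕ} {f : β → Fin n → σ} (h : Primrec f) (j : Fin n) :
    Primrec fun b => f b j :=
  (Primrec.fin_app.comp h (Primrec.const j) :)

theorem primrec_pi_update {n : ℕ} {f : β → Fin n → σ} {g : β → σ} (hf : Primrec f)
    (hg : Primrec g) (i : Fin n) : Primrec fun b => Function.update (f b) i (g b) := by
  refine primrec_pi_mk fun j => ?_
  obtain rfl | h := eq_or_ne j i
  · simpa only [Function.update_self] using hg
  · simpa only [Function.update_of_ne h] using primrec_pi_apply hf j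

theorem primrec_intEquivNatSumNat : Primrec Equiv.intEquivNatSumNat :=
  Primrec.encode_iff.1 (Primrec.encode.of_eq fun z => by cases z <;> rfl)

theorem primrec_intEquivNatSumNat_symm : Primrec Equiv.intEquivNatSumNat.symm :=
  Primrec.encode_iff.1 (Primrec.encode.of_eq fun z => by cases z <;> rfl)

theorem primrec_int_add_one : Primrec fun z : ℤ => z + 1 := by
  have h : Primrec fun z : ℤ => Equiv.intEquivNatSumNat.symm ((Equiv.intEquivNatSumNat z).casesOn
      (fun n => Sum.inl (n + 1)) fun n => n.casesOn (Sum.inl 0) Sum.inr) :=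
    primrec_intEquivNatSumNat_symm.comp (Primrec.sumCasesOn primrec_intEquivNatSumNat
      (Primrec.sumInl.comp (Primrec.succ.comp Primrec.snd)).to₂
      (Primrec.nat_casesOn Primrec.snd (Primrec.const _) (Primrec.sumInr.comp Primrec.snd).to₂).to₂)
  exact h.of_eq fun z => by rcases z with n | _ | n <;> rfl

theorem primrec_int_neg : Primrec fun z : ℤ => -z := by
  have h : Primrec fun z : ℤ => Equiv.intEquivNatSumNat.symm ((Equiv.intEquivNatSumNat z).casesOn
      (fun n => n.casesOn (Sum.inl 0) Sum.inr) fun n => Sum.inl (n + 1)) :=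
    primrec_intEquivNatSumNat_symm.comp (Primrec.sumCasesOn primrec_intEquivNatSumNat
      (Primrec.nat_casesOn Primrec.snd (Primrec.const _) (Primrec.sumInr.comp Primrec.snd).to₂).to₂
      (Primrec.sumInl.comp (Primrec.succ.comp Primrec.snd)).to₂)
  exact h.of_eq fun z => by rcases z with (_ | n) | n <;> rfl

theorem primrec_int_sub_one : Primrec fun z : ℤ => z - 1 :=
  (primrec_int_neg.comp (primrec_int_add_one.comp primrec_int_neg)).of_eq fun z => by ring

end Primrec

/-! ## Tapes as logs of writing operations -/

/-- A two-way infinite tape, given by the position of the head and the list of all writing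
operations `(cell, content)`, the last one first. Unlike functions `ℤ → C`, such tapes are
finite data and hence can be coded. -/
abbrev LogTape (C : Type*) := ℤ × List (ℤ × C)

namespace LogTape

variable {C : Type*}

/-- The content of cell `z`, which is `d` if nothing has been written there. -/
def read (d : C) (T : LogTape C) (z : ℤ) : C := (T.2.lookup z).getD d

/-- Write `x` on the scanned cell. -/
def write (x : C) (T : LogTape C) : LogTape C := (T.1, (T.1, x) :: T.2)

/-- Move the head; `none` means that it stays where it is. -/
def move : Option Turing.Dir → LogTape C → LogTape C
  | none, T => T
  | some Turing.Dir.left, T => (T.1 - 1, T.2)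
  | some Turing.Dir.right, T => (T.1 + 1, T.2)

theorem read_write (d x : C) (T : LogTape C) (z : ℤ) :
    (T.write x).read d z = if z = T.1 then x else T.read d z := by
  by_cases h : z = T.1
  · simp [read, write, h]
  · simp [read, write, h, List.lookup_cons, beq_eq_false_iff_ne.2 h]

@[simp] theorem read_move (d : C) (m : Option Turing.Dir) (T : LogTape C) :
    (T.move m).read d = T.read d := by
  rcases m with _ | _ | _ <;> rfl

variable [Primcodable C]

theorem primrec_read (d : C) : Primrec₂ (read d) :=
  Primrec.option_getD.comp (Primrec.listLookup.comp Primrec.snd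
    (Primrec.snd.comp Primrec.fst)) (Primrec.const d)

theorem primrec_write : Primrec₂ (write (C := C)) :=
  Primrec.pair (Primrec.fst.comp Primrec.snd) (Primrec.list_cons.comp
    (Primrec.pair (Primrec.fst.comp Primrec.snd) Primrec.fst) (Primrec.snd.comp Primrec.snd))

theorem primrec_move (m : Option Turing.Dir) : Primrec (move (C := C) m) := by
  rcases m with _ | _ | _
  · exact Primrec.id
  · exact Primrec.pair (primrec_int_sub_one.comp Primrec.fst) Primrec.snd
  · exact Primrec.pair (primrec_int_add_one.comp Primrec.fst) Primrec.snd

end LogTape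

open Filter Topology

/-! ## Approximation of sequences by prefixes -/

section Prefix

variable {A : Type u} {ι : Type*}

namespace OmegaWord

/-- The prefix of `p` of length `n`. -/
def take (p : OmegaWord A) (n : ℕ) : List A := List.ofFn fun i : Fin n => p i

@[simp] theorem length_take (p : OmegaWord A) (n : ℕ) : (p.take n).length = n :=
  List.length_ofFn

theorem take_succ (p : OmegaWord A) (n : ℕ) : p.take (n + 1) = p.take n ++ [p n] := by
  rw [take, List.ofFn_succ_last]
  rfl

theorem take_eq_take_iff {p q : OmegaWord A} {n : ℕ} :
    p.take n = q.take n ↔ ∀ i < n, p i = q i := by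
  simp only [take, List.ofFn_inj, funext_iff, Fin.forall_iff]

theorem isLocallyConstant_apply (i : ℕ) : IsLocallyConstant fun p : OmegaWord A => p i := by
  let : TopologicalSpace A := ⊥
  have : DiscreteTopology A := ⟨rfl⟩
  exact (IsLocallyConstant.iff_continuous _).2 (continuous_apply (A := fun _ : ℕ => A) i)

theorem isLocallyConstant_take (n : ℕ) : IsLocallyConstant fun p : OmegaWord A => p.take n :=
  (IsLocallyConstant.iff_eventually_eq _).2 fun p => by
    simp only [take_eq_take_iff]
    exact (Set.finite_lt_nat n).eventually_all.2 fun i _ =>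
      (isLocallyConstant_apply i).eventually_eq p

theorem continuous_of_isLocallyConstant_take {X : Type*} [TopologicalSpace X]
    {f : X → OmegaWord A} (h : ∀ n, IsLocallyConstant fun x => (f x).take n) : Continuous f := by
  let : TopologicalSpace A := ⊥
  refine (continuous_pi_iff (A := fun _ : ℕ => A)).2 fun i => IsLocallyConstant.continuous ?_
  refine (IsLocallyConstant.iff_eventually_eq _).2 fun x => ?_
  filter_upwards [(h (i + 1)).eventually_eq x] with y hy
  exact take_eq_take_iff.1 hy i i.lt_succ_self

theorem tendsto_of_take_eq {s : ℕ → OmegaWord A} {p : OmegaWord A}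
    (h : ∀ n, (s n).take n = p.take n) : Tendsto s atTop (𝓝 p) := by
  let : TopologicalSpace A := ⊥
  refine (tendsto_pi_nhds (A := fun _ : ℕ => A)).2 fun i => tendsto_nhds_of_eventually_eq ?_
  filter_upwards [eventually_gt_atTop i] with n hn using take_eq_take_iff.1 (h n) i hn

theorem hasBasis_nhds_pi [Finite ι] (p : ι → OmegaWord A) :
    (𝓝 p).HasBasis (fun _ : ℕ => True) fun n => {p' | ∀ i, (p' i).take n = (p i).take n} := by
  refine ⟨fun U => ⟨fun hU => ?_, fun ⟨n, _, hn⟩ => ?_⟩⟩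
  · by_contra! h
    choose s hs hsU using fun n => Set.not_subset.1 (h n trivial)
    have hsp : Tendsto s atTop (𝓝 p) := tendsto_pi_nhds.2 fun i => tendsto_of_take_eq (hs · i)
    obtain ⟨n, hn⟩ := (hsp.eventually hU).exists
    exact hsU n hn
  · exact mem_of_superset (eventually_all.2 fun i => (continuous_apply i).continuousAt.eventually
      ((isLocallyConstant_take n).eventually_eq (p i))) hn

end OmegaWord

/-- `w` is a prefix of `p`. -/
def IsPrefix (w : List A) (p : OmegaWord A) : Prop :=
  ∀ i a, w[i]? = some a → p i = a

theorem isPrefix_nil (p : OmegaWord A) : IsPrefix [] p := by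
  intro i a h
  simp at h

theorem isPrefix_take (p : OmegaWord A) (n : ℕ) : IsPrefix (p.take n) p := by
  intro i a h
  simp only [OmegaWord.take, List.getElem?_ofFn, Option.dite_none_right_eq_some,
    Option.some.injEq] at h
  exact h.2

namespace IsPrefix

variable {w : List A} {p q : OmegaWord A}

theorem getElem?_eq (h : IsPrefix w p) {i : ℕ} (hi : i < w.length) : w[i]? = some (p i) := by
  rw [List.getElem?_eq_getElem hi, h i _ (List.getElem?_eq_getElem hi)]

theorem eq_of_lt_length (hp : IsPrefix w p) (hq : IsPrefix w q) {i : ℕ} (hi : i < w.length) :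
    p i = q i :=
  Option.some.inj ((hp.getElem?_eq hi).symm.trans (hq.getElem?_eq hi))

theorem take_eq_take (hp : IsPrefix w p) (hq : IsPrefix w q) {n : ℕ} (hn : n ≤ w.length) :
    p.take n = q.take n :=
  OmegaWord.take_eq_take_iff.2 fun _ hi => hp.eq_of_lt_length hq (hi.trans_le hn)

theorem append_toList (h : IsPrefix w p) {o : Option A} (ho : ∀ a, o = some a → p w.length = a) :
    IsPrefix (w ++ o.toList) p := by
  intro i b hb
  rcases lt_or_ge i w.length with hi | hi
  · exact h i b (by rwa [List.getElem?_append_left hi] at hb)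
  · rw [List.getElem?_append_right hi] at hb
    cases o with
    | none => simp at hb
    | some a =>
      simp only [Option.toList_some, List.getElem?_singleton, Option.ite_none_right_eq_some] at hb
      rw [hi.antisymm' (Nat.sub_eq_zero_iff_le.1 hb.1)]
      exact ho b hb.2

end IsPrefix

/-- `R n d x` says that the finite datum `d` approximates `x` with precision `n`. -/
abbrev ApproxRel (D X : Type*) := ℕ → D → X → Prop

namespace ApproxRel

/-- The discrete approximation: the only approximation of `x` is `x`. -/
def discrete (X : Type*) : ApproxRel X X := fun _ d x => d = x

/-- Sequences are approximated by their prefixes; the precision is a bound on the length. -/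
def word (A : Type u) : ApproxRel (List A) (OmegaWord A) := fun n w p => IsPrefix w p ∧ n ≤ w.length

/-- The coordinatewise approximation of tuples. -/
def tuple {ι D X : Type*} (R : ApproxRel D X) : ApproxRel (ι → D) (ι → X) :=
  fun n d x => ∀ i, R n (d i) (x i)

/-- Approximations that may be undefined: `none` gives no information, so its precision is `0`. -/
def option {D X : Type*} (R : ApproxRel D X) : ApproxRel (Option D) X :=
  fun n d x => d.elim (n = 0) fun d => R n d x

theorem antitone_word (w : List A) (p : OmegaWord A) : Antitone (word A · w p) :=
  fun _ _ hmn h => ⟨h.1, hmn.trans h.2⟩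

theorem antitone_option {D X : Type*} {R : ApproxRel D X} (hR : ∀ d x, Antitone (R · d x))
    (d : Option D) (x : X) : Antitone (R.option · d x) := by
  intro m n hmn h
  cases d with
  | none => exact Nat.eq_zero_of_le_zero (hmn.trans_eq h)
  | some d => exact hR d x hmn h

theorem exists_eq_some_of_option {D X : Type*} {R : ApproxRel D X} {n : ℕ} (hn : n ≠ 0)
    {d : Option D} {x : X} (h : R.option n d x) : ∃ e, d = some e ∧ R n e x := by
  cases d with
  | none => exact absurd h hn
  | some e => exact ⟨e, rfl, h⟩

theorem word_zero_iff {w : List A} {p : OmegaWord A} : word A 0 w p ↔ IsPrefix w p :=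
  and_iff_left (Nat.zero_le _)

theorem tuple_word_take (p : ι → OmegaWord A) (n : ℕ) :
    (word A).tuple n (fun i => (p i).take n) p :=
  fun _ => ⟨isPrefix_take _ _, (OmegaWord.length_take _ _).ge⟩

theorem tuple_word_zero_take (p : ι → OmegaWord A) (n : ℕ) :
    (word A).tuple 0 (fun i => (p i).take n) p :=
  fun _ => word_zero_iff.2 (isPrefix_take _ _)

end ApproxRel

/-- `Φ` realizes the multi-function `F`: from a time `t` and approximations of the argument, it
finds approximations of each value of `F`, and their precision tends to infinity. The time
matters for functions without arguments, and for those with arguments of discrete type. -/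
structure Realizes {D E X Y : Type*} (R : ApproxRel D X) (S : ApproxRel E Y) (F : MultiFun X Y)
    (Φ : ℕ → D → E) : Prop where
  sound : ∀ x, ∀ y ∈ F x, ∀ t d, R 0 d x → S 0 (Φ t d) y
  complete : ∀ x, ∀ y ∈ F x, ∀ j, ∀ᶠ n in atTop, ∀ t ≥ n, ∀ d, R n d x → S j (Φ t d) y

section Composition

variable {C D X Y : Type*} {Q : ApproxRel C X} {R : ApproxRel D Y}

theorem Realizes.of_forall_precision {F : MultiFun X Y} {φ : C → D}
    (hR : ∀ d y, Antitone (R · d y)) (h : ∀ n x, ∀ y ∈ F x, ∀ c, Q n c x → R n (φ c) y) :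
    Realizes Q R F fun _ => φ where
  sound x y hy _ c hc := h 0 x y hy c hc
  complete x y hy j := by
    filter_upwards [eventually_ge_atTop j] with n hn t _ c hc using hR _ _ hn (h n x y hy c hc)

theorem Realizes.mono {F G : MultiFun X Y} {Φ : ℕ → C → D} (h : Realizes Q R G Φ)
    (hFG : ∀ x, F x ⊆ G x) : Realizes Q R F Φ where
  sound x y hy := h.sound x y (hFG x hy)
  complete x y hy := h.complete x y (hFG x hy)

theorem Realizes.option_bind {F : MultiFun X Y} {Φ : ℕ → C → Option D}
    (h : Realizes Q R.option F Φ) :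
    Realizes Q.option R.option F fun t c => c.bind (Φ t) where
  sound x y hy t c hc := by
    cases c with
    | none => rfl
    | some c => exact h.sound x y hy t c hc
  complete x y hy j := by
    filter_upwards [h.complete x y hy j, eventually_ne_atTop 0] with n hn hn0 t ht c hc
    obtain ⟨c, rfl, -⟩ := ApproxRel.exists_eq_some_of_option hn0 hc
    exact hn t ht c hc

end Composition

section Iterate

variable {D X : Type*} {R : ApproxRel D X} {F : MultiFun X X} {Φ : ℕ → D → D}

theorem Realizes.sound_iterate (h : Realizes R R F Φ) {x : ℕ → X}
    (hx : ∀ m, x (m + 1) ∈ F (x m)) {t : ℕ} {d : D} (hd : R 0 d (x 0)) (m : ℕ) :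
    R 0 ((Φ t)^[m] d) (x m) := by
  induction m with
  | zero => exact hd
  | succ m ih => simpa only [Function.iterate_succ_apply'] using h.sound _ _ (hx m) t _ ih

theorem Realizes.complete_iterate (h : Realizes R R F Φ) (hR : ∀ d x, Antitone (R · d x))
    {x : ℕ → X}
    (hx : ∀ m, x (m + 1) ∈ F (x m)) (m j : ℕ) :
    ∀ᶠ n in atTop, ∀ t ≥ n, ∀ d, R n d (x 0) → R j ((Φ t)^[m] d) (x m) := by
  induction m generalizing j with
  | zero =>
    filter_upwards [eventually_ge_atTop j] with n hn t _ d hd using hR _ _ hn hd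
  | succ m ih =>
    obtain ⟨i, hi⟩ := (h.complete _ _ (hx m) j).exists
    filter_upwards [ih i, eventually_ge_atTop i] with n hn hni t ht d hd
    rw [Function.iterate_succ_apply']
    exact hi t (hni.trans ht) _ (hn t ht d hd)

end Iterate

end Prefix

/-! ## Continuous functions are the realized ones -/

section Continuity

open ApproxRel

variable {A : Type u} {k : ℕ}

theorem MultiFun.exists_eq_ofPFun {X : Type u} {Y : Type v} {F : MultiFun X Y}
    (h : ∀ x, (F x).Subsingleton) : ∃ g : X →. Y, F = MultiFun.ofPFun g := by
  refine ⟨fun x => ⟨(F x).Nonempty, Set.Nonempty.some⟩, funext fun x => Set.ext fun y => ⟨?_, ?_⟩⟩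
  · exact fun hy => ⟨⟨y, hy⟩, h x (Set.Nonempty.some_mem _) hy⟩
  · rintro ⟨hx, rfl⟩
    exact hx.some_mem

theorem Realizes.exists_take_eq {F : MultiFun (Fin k → OmegaWord A) (OmegaWord A)}
    {Φ : ℕ → (Fin k → List A) → List A} (h : Realizes (word A).tuple (word A) F Φ)
    {p : Fin k → OmegaWord A} {q : OmegaWord A} (hq : q ∈ F p) (j : ℕ) :
    ∃ n, ∀ p' : Fin k → OmegaWord A, (∀ i, (p' i).take n = (p i).take n) →
      ∀ q' ∈ F p', q'.take j = q.take j := by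
  obtain ⟨n, hn⟩ := (h.complete p q hq j).exists
  refine ⟨n, fun p' hp' q' hq' => ?_⟩
  obtain ⟨hprefix, hlength⟩ := hn n le_rfl _ (tuple_word_take p n)
  have hprefix' := word_zero_iff.1 (h.sound p' q' hq' n _ (tuple_word_zero_take p' n))
  simp only [hp'] at hprefix'
  exact hprefix'.take_eq_take hprefix hlength

theorem Realizes.subsingleton {F : MultiFun (Fin k → OmegaWord A) (OmegaWord A)}
    {Φ : ℕ → (Fin k → List A) → List A} (h : Realizes (word A).tuple (word A) F Φ)
    (p : Fin k → OmegaWord A) : (F p).Subsingleton := by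
  intro q' hq' q hq
  funext j
  obtain ⟨n, hn⟩ := h.exists_take_eq hq (j + 1)
  exact OmegaWord.take_eq_take_iff.1 (hn p (fun _ => rfl) q' hq') j j.lt_succ_self

theorem Realizes.pfunContinuous {g : (Fin k → OmegaWord A) →. OmegaWord A}
    {Φ : ℕ → (Fin k → List A) → List A}
    (h : Realizes (word A).tuple (word A) (MultiFun.ofPFun g) Φ) : PFunContinuous g := by
  refine OmegaWord.continuous_of_isLocallyConstant_take fun j => ?_
  refine (IsLocallyConstant.iff_eventually_eq _).2 fun x => ?_
  obtain ⟨n, hn⟩ := h.exists_take_eq (q := g.fn x.1 x.2) ⟨x.2, rfl⟩ j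
  have hx := (OmegaWord.hasBasis_nhds_pi x.1).mem_of_mem (i := n) trivial
  filter_upwards [continuous_subtype_val.continuousAt.preimage_mem_nhds hx] with y hy
  exact hn y.1 hy _ ⟨y.2, rfl⟩

instance : DiscreteTopology (FinWord A) := ⟨rfl⟩

theorem PFunContinuous.exists_realizes_discrete {Z : Type*} [TopologicalSpace Z]
    [DiscreteTopology Z] {f : (Fin k → OmegaWord A) →. Z} (hf : PFunContinuous f) :
    ∃ Ψ, Realizes (word A).tuple (discrete Z).option (MultiFun.ofPFun f) Ψ := by
  classical
  let IsValue (w : Fin k → List A) (z : Z) : Prop :=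
    ∀ p, (∀ i, IsPrefix (w i) (p i)) → ∀ y ∈ f p, z = y
  refine ⟨fun _ w => if h : ∃ z, IsValue w z then some h.choose else none, ?_, ?_⟩
  · intro p y hy _ w hw
    simp only [tuple, word_zero_iff] at hw
    split_ifs with h
    · exact h.choose_spec p hw y hy
    · rfl
  · rintro p _ ⟨hp, rfl⟩ j
    have hconst : ∀ᶠ p' in 𝓝 p, ∀ x : f.Dom, x.1 = p' → f.fn x.1 x.2 = f.fn p hp := by
      rw [← eventually_comap (f := Subtype.val), ← nhds_subtype (x := (⟨p, hp⟩ : f.Dom))]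
      exact ((IsLocallyConstant.iff_continuous _).2 hf).eventually_eq ⟨p, hp⟩
    obtain ⟨n, -, hn⟩ := (OmegaWord.hasBasis_nhds_pi p).eventually_iff.1 hconst
    filter_upwards [eventually_ge_atTop n] with m hm t _ w hw
    have hvalue : ∃ z, IsValue w z := ⟨f.fn p hp, by
      rintro p' hw' _ ⟨hp', rfl⟩
      exact (hn (fun i => (hw' i).take_eq_take (hw i).1 (hm.trans (hw i).2)) ⟨p', hp'⟩ rfl).symm⟩
    rw [dif_pos hvalue]
    exact hvalue.choose_spec p (fun i => (hw i).1) _ ⟨hp, rfl⟩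

theorem PFunContinuous.exists_realizes_word {g : (Fin k → OmegaWord A) →. OmegaWord A}
    (hg : PFunContinuous g) :
    ∃ Φ, Realizes (word A).tuple (word A) (MultiFun.ofPFun g) Φ := by
  have htake (j : ℕ) : PFunContinuous (Y := FinWord A) fun p => (g p).map (OmegaWord.take · j) :=
    ((OmegaWord.isLocallyConstant_take j).continuous (Y := FinWord A)).comp hg
  have hrealizes (j : ℕ) : ∃ Ψ, Realizes (word A).tuple (discrete (List A)).option
      (MultiFun.ofPFun fun p => (g p).map (OmegaWord.take · j)) Ψ :=
    (htake j).exists_realizes_discrete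
  choose Ψ hΨ using hrealizes
  let best (t : ℕ) (w : Fin k → List A) : ℕ := Nat.findGreatest (fun j => (Ψ j t w).isSome) t
  have hsound {p q t w j u} (hq : q ∈ g p) (hw : (word A).tuple 0 w p) (hu : Ψ j t w = some u) :
      u = q.take j := by
    have h := (hΨ j).sound p _ (Part.mem_map _ hq) t w hw
    rwa [hu] at h
  refine ⟨fun t w => (Ψ (best t w) t w).getD [], fun p q hq t w hw => ?_, fun p q hq j => ?_⟩
  · rw [word_zero_iff]
    cases hu : Ψ (best t w) t w with
    | none => exact isPrefix_nil q
    | some u => exact hsound hq hw hu ▸ isPrefix_take q _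
  · filter_upwards [(hΨ j).complete p _ (Part.mem_map _ hq) 1, eventually_ge_atTop j]
      with n hn hjn t ht w hw
    obtain ⟨u, hu, -⟩ := exists_eq_some_of_option one_ne_zero (hn t ht w hw)
    have hj : (Ψ j t w).isSome := Option.isSome_iff_exists.2 ⟨u, hu⟩
    have hjbest : j ≤ best t w := Nat.le_findGreatest (hjn.trans ht) hj
    obtain ⟨u, hu⟩ := Option.isSome_iff_exists.1
      (Nat.findGreatest_spec (P := fun j => (Ψ j t w).isSome) (hjn.trans ht) hj)
    rw [hu, hsound hq (fun i => (hw i).imp_right fun _ => Nat.zero_le _) hu]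
    exact ⟨isPrefix_take q _, hjbest.trans_eq (OmegaWord.length_take _ _).symm⟩

end Continuity

/-! ## Simulation of Type-2 machines on prefixes -/

namespace TypeTwoMachine

open ApproxRel

variable {A : Type u} {k : ℕ} {M : TypeTwoMachine A k} {p : Fin k → OmegaWord A}

theorem exists_run_eq_some_of_run_succ {n : ℕ} {κ' : M.Config} (h : M.run p (n + 1) = some κ') :
    ∃ κ, M.run p n = some κ ∧ M.step p κ = some κ' :=
  Option.bind_eq_some_iff.1 h

theorem out_prefix_of_run {m n : ℕ} (hmn : m ≤ n) {κ κ' : M.Config} (h : M.run p m = some κ)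
    (h' : M.run p n = some κ') : κ.out <+: κ'.out := by
  induction n, hmn using Nat.le_induction generalizing κ' with
  | base => rw [Option.some.inj (h.symm.trans h')]
  | succ n _ ih =>
    obtain ⟨κ₁, hκ₁, hstep⟩ := exists_run_eq_some_of_run_succ h'
    obtain ⟨t, -, rfl⟩ := Option.map_eq_some_iff.1 hstep
    exact (ih hκ₁).trans (List.prefix_append _ _)

theorem OutputsSeq.isPrefix_out {q : OmegaWord A} (hq : M.OutputsSeq p q) {n : ℕ} {κ : M.Config}
    (h : M.run p n = some κ) : IsPrefix κ.out q := by
  intro i a ha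
  obtain ⟨m, κ', h', hq'⟩ := hq.2 i
  obtain ⟨hi, rfl⟩ := List.getElem?_eq_some_iff.1 ha
  obtain ⟨hi', hq'⟩ := List.getElem?_eq_some_iff.1 hq'
  obtain hnm | hmn := le_total n m
  · rw [← hq', (out_prefix_of_run hnm h h').getElem hi]
  · rw [← hq', (out_prefix_of_run hmn h' h).getElem hi']

theorem OutputsSeq.unique {q q' : OmegaWord A} (h : M.OutputsSeq p q) (h' : M.OutputsSeq p q') :
    q = q' := by
  funext j
  obtain ⟨n, κ, hκ, hj⟩ := h.2 j
  exact (h'.isPrefix_out hκ j _ hj).symm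

theorem le_of_step_eq_none {m n : ℕ} {κ κ' : M.Config} (h : M.run p n = some κ)
    (hhalt : M.step p κ = none) (h' : M.run p m = some κ') : m ≤ n := by
  by_contra! hlt
  have hnone (d : ℕ) : M.run p (n + 1 + d) = none := by
    induction d with
    | zero => rw [Nat.add_zero, run, h, Option.bind_some, hhalt]
    | succ d ih => rw [← Nat.add_assoc, run, ih, Option.bind_none]
  obtain ⟨d, rfl⟩ := Nat.exists_eq_add_of_le hlt
  rw [hnone] at h'
  cases h'

theorem OutputsWord.unique {v v' : FinWord A} (h : M.OutputsWord p v)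
    (h' : M.OutputsWord p v') : v = v' := by
  obtain ⟨n, κ, hκ, hhalt, rfl⟩ := h
  obtain ⟨n', κ', hκ', hhalt', rfl⟩ := h'
  obtain rfl := (le_of_step_eq_none hκ' hhalt' hκ).antisymm (le_of_step_eq_none hκ hhalt hκ')
  rw [Option.some.inj (hκ.symm.trans hκ')]

/-- What `M` does in one step, as given by the transition function: the new state, the motions of
the input heads, the actions on the work tapes, and the symbol that is appended to the output. -/
abbrev Action (M : TypeTwoMachine A k) : Type u :=
  M.State × (Fin k → Option Turing.Dir) × (Fin M.workTapes → M.Work × Option Turing.Dir) × Option A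

/-- A symbolic configuration: the components of a configuration, with logs as work tapes. -/
abbrev SymConfig (M : TypeTwoMachine A k) : Type u :=
  M.State × (Fin k → ℕ) × (Fin M.workTapes → LogTape M.Work) × List A

/-- The symbolic configuration `c` represents the configuration `κ`. -/
structure Represents (c : M.SymConfig) (κ : M.Config) : Prop where
  state_eq : c.1 = κ.state
  inputHead_eq : c.2.1 = κ.inputHead
  read_eq : ∀ j z, (c.2.2.1 j).read default ((c.2.2.1 j).1 + z) = (κ.work j).nth z
  out_eq : c.2.2.2 = κ.out

/-- The data on which the next action depends, if only prefixes of the inputs are known; a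
scanned input symbol beyond the prefix is `none`. -/
abbrev View (M : TypeTwoMachine A k) : Type u :=
  M.State × (Fin k → Option A) × (Fin M.workTapes → M.Work)

open Classical in
/-- The next action for a view, where `some none` means that the machine halts; `none` if a
scanned input symbol is not known. -/
noncomputable def View.next (v : M.View) : Option (Option M.Action) :=
  if h : ∃ a : Fin k → A, ∀ i, v.2.1 i = some (a i) then some (M.next v.1 h.choose v.2.2) else none

/-- Perform an action. -/
def Config.perform (κ : M.Config) (a : M.Action) : M.Config where
  state := a.1
  inputHead i := moveInput (a.2.1 i) (κ.inputHead i)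
  work j := actWork (a.2.2.1 j) (κ.work j)
  out := κ.out ++ a.2.2.2.toList

namespace SymConfig

/-- The view of a configuration on the prefixes `w` of the inputs. -/
def view (w : Fin k → List A) (c : M.SymConfig) : M.View :=
  (c.1, fun i => (w i)[c.2.1 i]?, fun j => (c.2.2.1 j).read default (c.2.2.1 j).1)

/-- Perform an action. -/
def perform (c : M.SymConfig) (a : M.Action) : M.SymConfig :=
  (a.1, fun i => moveInput (a.2.1 i) (c.2.1 i),
    fun j => ((c.2.2.1 j).write (a.2.2.1 j).1).move (a.2.2.1 j).2, c.2.2.2 ++ a.2.2.2.toList)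

/-- One step on the prefixes `w` of the inputs; nothing changes if the machine halts, or if a
scanned input symbol is not known. -/
noncomputable def step (w : Fin k → List A) (c : M.SymConfig) : M.SymConfig :=
  (c.view w).next.join.elim c c.perform

/-- The initial symbolic configuration. -/
def init (M : TypeTwoMachine A k) : M.SymConfig := (M.start, fun _ => 0, fun _ => (0, []), [])

end SymConfig

theorem represents_init : Represents (SymConfig.init M) M.init where
  state_eq := rfl
  inputHead_eq := rfl
  read_eq _ z := by
    change (default : M.Work) = (default : Turing.Tape M.Work).nth z
    rcases z with (_ | _) | _ <;> rfl
  out_eq := rfl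

theorem read_move_write_eq_nth_actWork {W : Type} [Inhabited W] (a : W × Option Turing.Dir)
    {T : LogTape W} {T' : Turing.Tape W} (h : ∀ z, T.read default (T.1 + z) = T'.nth z) (z : ℤ) :
    ((T.write a.1).move a.2).read default (((T.write a.1).move a.2).1 + z) =
      (actWork a T').nth z := by
  have hwrite (y : ℤ) : (T.write a.1).read default (T.1 + y) = (T'.write a.1).nth y := by
    simp [LogTape.read_write, h]
  obtain ⟨x, _ | _ | _⟩ := a <;> rw [LogTape.read_move]
  · exact hwrite z
  · have hhead : ((T.write x).move (some .left)).1 + z = T.1 + (z - 1) := by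
      simp only [LogTape.move, LogTape.write]
      ring
    rw [hhead, hwrite]
    exact (Turing.Tape.move_left_nth _ _).symm
  · have hhead : ((T.write x).move (some .right)).1 + z = T.1 + (z + 1) := by
      simp only [LogTape.move, LogTape.write]
      ring
    rw [hhead, hwrite]
    exact (Turing.Tape.move_right_nth _ _).symm

section Represents

variable {w : Fin k → List A} {c : M.SymConfig} {κ : M.Config}

theorem Represents.view_eq (h : Represents c κ) :
    c.view w = (κ.state, fun i => (w i)[κ.inputHead i]?, fun j => (κ.work j).head) := by
  have hwork (j) : (c.2.2.1 j).read default (c.2.2.1 j).1 = (κ.work j).head := by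
    simpa using h.read_eq j 0
  simp only [SymConfig.view, h.state_eq, h.inputHead_eq, hwork]

theorem Represents.next_view_eq_some (h : Represents c κ) (hw : ∀ i, IsPrefix (w i) (p i))
    (hlength : ∀ i, κ.inputHead i < (w i).length) :
    (c.view w).next =
      some (M.next κ.state (fun i => p i (κ.inputHead i)) fun j => (κ.work j).head) := by
  have hread : ∃ a : Fin k → A, ∀ i, (w i)[κ.inputHead i]? = some (a i) :=
    ⟨_, fun i => (hw i).getElem?_eq (hlength i)⟩
  rw [h.view_eq, View.next, dif_pos hread, funext fun i => hw i _ _ (hread.choose_spec i)]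

theorem Represents.eq_next_of_next_view_eq_some (h : Represents c κ)
    (hw : ∀ i, IsPrefix (w i) (p i)) {a : Option M.Action} (ha : (c.view w).next = some a) :
    a = M.next κ.state (fun i => p i (κ.inputHead i)) fun j => (κ.work j).head := by
  refine Option.some.inj (ha.symm.trans (h.next_view_eq_some hw fun i => ?_))
  rw [h.view_eq, View.next] at ha
  split_ifs at ha with hread
  exact (List.getElem?_eq_some_iff.1 (hread.choose_spec i)).1

theorem Represents.perform (h : Represents c κ) (a : M.Action) :
    Represents (c.perform a) (κ.perform a) where
  state_eq := rfl
  inputHead_eq := by simp only [SymConfig.perform, Config.perform, h.inputHead_eq]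
  read_eq j := read_move_write_eq_nth_actWork _ (h.read_eq j)
  out_eq := by simp only [SymConfig.perform, Config.perform, h.out_eq]

theorem Represents.step (h : Represents c κ) (hw : ∀ i, IsPrefix (w i) (p i)) :
    Represents (c.step w) κ ∨ ∃ κ', M.step p κ = some κ' ∧ Represents (c.step w) κ' := by
  rw [SymConfig.step]
  rcases hnext : (c.view w).next with _ | _ | a
  · exact .inl h
  · exact .inl h
  · refine .inr ⟨κ.perform a, ?_, h.perform a⟩
    rw [TypeTwoMachine.step, ← h.eq_next_of_next_view_eq_some hw hnext]
    rfl

theorem Represents.step_of_eq_some (h : Represents c κ) (hw : ∀ i, IsPrefix (w i) (p i))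
    (hlength : ∀ i, κ.inputHead i < (w i).length) {κ' : M.Config} (hκ' : M.step p κ = some κ') :
    Represents (c.step w) κ' := by
  obtain ⟨a, ha, rfl⟩ := Option.map_eq_some_iff.1 hκ'
  rw [SymConfig.step, h.next_view_eq_some hw hlength, ha]
  exact h.perform a

theorem Represents.next_view_eq_some_none_iff (h : Represents c κ) (hw : ∀ i, IsPrefix (w i) (p i))
    (hlength : ∀ i, κ.inputHead i < (w i).length) :
    (c.view w).next = some none ↔ M.step p κ = none := by
  rw [h.next_view_eq_some hw hlength, Option.some_inj, TypeTwoMachine.step,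
    Option.map_eq_none_iff]

theorem Represents.step_eq_none (h : Represents c κ) (hw : ∀ i, IsPrefix (w i) (p i))
    (hnext : (c.view w).next = some none) : M.step p κ = none := by
  rw [TypeTwoMachine.step, ← h.eq_next_of_next_view_eq_some hw hnext, Option.map_none]

end Represents

variable (M) in
/-- The symbolic configuration after `t` steps on the prefixes `w` of the inputs. -/
noncomputable def symRun (t : ℕ) (w : Fin k → List A) : M.SymConfig :=
  (SymConfig.step w)^[t] (SymConfig.init M)

theorem exists_represents_symRun {w : Fin k → List A} (hw : ∀ i, IsPrefix (w i) (p i)) (t : ℕ) :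
    ∃ n κ, M.run p n = some κ ∧ Represents (M.symRun t w) κ := by
  induction t with
  | zero => exact ⟨0, _, rfl, represents_init⟩
  | succ t ih =>
    obtain ⟨n, κ, hκ, h⟩ := ih
    rw [symRun, Function.iterate_succ_apply']
    obtain h | ⟨κ', hκ', h⟩ := h.step hw
    · exact ⟨n, κ, hκ, h⟩
    · exact ⟨n + 1, κ', by rw [run, hκ, Option.bind_some, hκ'], h⟩

theorem eventually_inputHead_lt (κ : M.Config) (p : Fin k → OmegaWord A) :
    ∀ᶠ n in atTop, ∀ w, (word A).tuple n w p → ∀ i, κ.inputHead i < (w i).length := by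
  filter_upwards [eventually_all.2 fun i => eventually_gt_atTop (κ.inputHead i)] with n hn w hw i
  exact (hn i).trans_le (hw i).2

theorem eventually_represents_symRun {r : ℕ} {κ : M.Config} (hκ : M.run p r = some κ) :
    ∀ᶠ n in atTop, ∀ w, (word A).tuple n w p → Represents (M.symRun r w) κ := by
  induction r generalizing κ with
  | zero =>
    cases hκ
    exact .of_forall fun _ _ _ => represents_init
  | succ r ih =>
    obtain ⟨κ₁, hκ₁, hstep⟩ := exists_run_eq_some_of_run_succ hκ
    filter_upwards [ih hκ₁, eventually_inputHead_lt κ₁ p] with n hn hlength w hw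
    rw [symRun, Function.iterate_succ_apply']
    exact (hn w hw).step_of_eq_some (fun i => (hw i).1) (hlength w hw) hstep

/-- The word on the output tape after `t` steps on prefixes of the inputs. -/
noncomputable def approxSeq (M : TypeTwoMachine A k) (t : ℕ) (w : Fin k → List A) : List A :=
  (M.symRun t w).2.2.2

open Classical in
/-- The word on the output tape if the machine has halted after `t` steps on prefixes. -/
noncomputable def approxWord (M : TypeTwoMachine A k) (t : ℕ) (w : Fin k → List A) :
    Option (List A) :=
  if ((M.symRun t w).view w).next = some none then some (M.approxSeq t w) else none

theorem length_approxSeq_mono (M : TypeTwoMachine A k) (w : Fin k → List A) :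
    Monotone fun t => (M.approxSeq t w).length := by
  refine monotone_nat_of_le_succ fun t => ?_
  simp only [approxSeq, symRun, Function.iterate_succ_apply', SymConfig.step]
  rcases (SymConfig.view w ((SymConfig.step w)^[t] (SymConfig.init M))).next.join with _ | a
  · exact le_rfl
  · exact (List.prefix_append _ _).length_le

theorem OutputsSeq.isPrefix_approxSeq {q : OmegaWord A} (hq : M.OutputsSeq p q)
    {w : Fin k → List A} (hw : ∀ i, IsPrefix (w i) (p i)) (t : ℕ) :
    IsPrefix (M.approxSeq t w) q := by
  obtain ⟨n, κ, hκ, h⟩ := exists_represents_symRun hw t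
  rw [approxSeq, h.out_eq]
  exact hq.isPrefix_out hκ

theorem realizes_approxSeq (M : TypeTwoMachine A k) :
    Realizes (word A).tuple (word A) (fun p => {q | M.OutputsSeq p q}) M.approxSeq where
  sound p q hq t w hw := word_zero_iff.2 (hq.isPrefix_approxSeq (fun i => (hw i).1) t)
  complete p q hq j := by
    obtain ⟨r, κ, hκ, hj⟩ := hq.2 j
    filter_upwards [eventually_represents_symRun hκ, eventually_ge_atTop r] with n hn hrn t ht w hw
    refine ⟨hq.isPrefix_approxSeq (fun i => (hw i).1) t, ?_⟩
    refine le_trans ?_ (M.length_approxSeq_mono w (hrn.trans ht))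
    simp only [approxSeq, (hn w hw).out_eq]
    exact (List.getElem?_eq_some_iff.1 hj).1.le

theorem realizes_approxWord (M : TypeTwoMachine A k) :
    Realizes (word A).tuple (discrete (List A)).option (fun p => {v | M.OutputsWord p v})
      M.approxWord where
  sound p v hv t w hw := by
    obtain ⟨n, κ, hκ, h⟩ := exists_represents_symRun (M := M) (fun i => (hw i).1) t
    rw [approxWord]
    split_ifs with hnext
    · have hhalt := h.step_eq_none (fun i => (hw i).1) hnext
      exact OutputsWord.unique ⟨n, κ, hκ, hhalt, h.out_eq.symm⟩ hv
    · rfl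
  complete p v hv j := by
    obtain ⟨r, κ, hκ, hhalt, rfl⟩ := hv
    filter_upwards [eventually_represents_symRun hκ, eventually_inputHead_lt κ p,
      eventually_ge_atTop r] with n hn hlength hrn t ht w hw
    have hrep := hn w hw
    have hnext := (hrep.next_view_eq_some_none_iff (fun i => (hw i).1) (hlength w hw)).2 hhalt
    have hstep : (M.symRun r w).step w = M.symRun r w := by
      rw [SymConfig.step, hnext, Option.join_some, Option.elim_none]
    obtain ⟨d, rfl⟩ := Nat.exists_eq_add_of_le' (hrn.trans ht)
    have hrun : M.symRun (d + r) w = M.symRun r w := by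
      rw [symRun, Function.iterate_add_apply]
      exact Function.iterate_fixed hstep d
    rw [approxWord, approxSeq, hrun, if_pos hnext]
    exact hrep.out_eq

section Primrec

variable [Primcodable A] [Primcodable M.State] [Primcodable M.Work]

theorem SymConfig.primrec_perform (a : M.Action) : Primrec fun c : M.SymConfig => c.perform a := by
  have hhead (i : Fin k) : Primrec fun c : M.SymConfig => c.2.1 i :=
    primrec_pi_apply (Primrec.fst.comp Primrec.snd) i
  have hwork (j : Fin M.workTapes) : Primrec fun c : M.SymConfig => c.2.2.1 j :=
    primrec_pi_apply (Primrec.fst.comp (Primrec.snd.comp Primrec.snd)) j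
  refine Primrec.pair (Primrec.const _) (Primrec.pair (primrec_pi_mk fun i => ?_)
    (Primrec.pair (primrec_pi_mk fun j => ?_) ?_))
  · rcases a.2.1 i with _ | _ | _
    · exact hhead i
    · exact Primrec.pred.comp (hhead i)
    · exact Primrec.succ.comp (hhead i)
  · exact (LogTape.primrec_move _).comp (LogTape.primrec_write.comp (Primrec.const _) (hwork j))
  · exact Primrec.list_append.comp (Primrec.snd.comp (Primrec.snd.comp Primrec.snd))
      (Primrec.const _)

theorem SymConfig.primrec₂_view :
    Primrec₂ (SymConfig.view : (Fin k → List A) → M.SymConfig → M.View) := by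
  have hwork (j : Fin M.workTapes) :
      Primrec fun x : (Fin k → List A) × M.SymConfig => x.2.2.2.1 j :=
    primrec_pi_apply (Primrec.fst.comp (Primrec.snd.comp (Primrec.snd.comp Primrec.snd))) j
  refine Primrec.pair (Primrec.fst.comp Primrec.snd) (Primrec.pair (primrec_pi_mk fun i => ?_)
    (primrec_pi_mk fun j => ?_))
  · exact Primrec.list_getElem?.comp (primrec_pi_apply Primrec.fst i)
      (primrec_pi_apply (Primrec.fst.comp (Primrec.snd.comp Primrec.snd)) i)
  · exact (LogTape.primrec_read _).comp (hwork j) (Primrec.fst.comp (hwork j))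

variable [Finite A]

theorem SymConfig.primrec₂_step :
    Primrec₂ (SymConfig.step : (Fin k → List A) → M.SymConfig → M.SymConfig) := by
  have h : Primrec₂ fun (v : M.View) (c : M.SymConfig) => v.next.join.elim c c.perform :=
    primrec₂_of_finite fun v => by
      rcases v.next.join with _ | a
      · exact Primrec.id
      · exact SymConfig.primrec_perform a
  exact h.comp SymConfig.primrec₂_view Primrec.snd

theorem primrec₂_symRun : Primrec₂ M.symRun :=
  Primrec.nat_iterate Primrec.fst (Primrec.const _)
    (SymConfig.primrec₂_step.comp (Primrec.snd.comp Primrec.fst) Primrec.snd).to₂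

theorem primrec₂_approxSeq : Primrec₂ M.approxSeq :=
  Primrec.snd.comp (Primrec.snd.comp (Primrec.snd.comp primrec₂_symRun))

theorem primrec₂_approxWord : Primrec₂ M.approxWord := by
  classical
  have h : Primrec₂ fun (v : M.View) (u : List A) => if v.next = some none then some u else none :=
    primrec₂_of_finite fun v => by
      split_ifs
      · exact Primrec.option_some
      · exact Primrec.const none
  exact h.comp (SymConfig.primrec₂_view.comp Primrec.snd primrec₂_symRun) primrec₂_approxSeq

end Primrec

end TypeTwoMachine

section Computable

open ApproxRel

variable {A : Type u} [Finite A] [Primcodable A] {k : ℕ}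

theorem ComputableSeq.exists_realizes {g : (Fin k → OmegaWord A) →. OmegaWord A}
    (hg : ComputableSeq g) :
    ∃ Φ, Realizes (word A).tuple (word A) (MultiFun.ofPFun g) Φ ∧ Primrec₂ Φ := by
  obtain ⟨f, ⟨M, hM⟩, hf⟩ := hg
  let := primcodableOfFinite M.State
  let := primcodableOfFinite M.Work
  exact ⟨M.approxSeq, M.realizes_approxSeq.mono fun p q hq => (hM p q).1 (hf p q hq),
    M.primrec₂_approxSeq⟩

theorem ComputableWord.exists_realizes {f : (Fin k → OmegaWord A) →. FinWord A}
    (hf : ComputableWord f) :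
    ∃ Ψ, Realizes (word A).tuple (discrete (List A)).option (MultiFun.ofPFun f) Ψ ∧
      Primrec₂ Ψ := by
  obtain ⟨g, ⟨M, hM⟩, hg⟩ := hf
  let := primcodableOfFinite M.State
  let := primcodableOfFinite M.Work
  exact ⟨M.approxWord, M.realizes_approxWord.mono fun p v hv => (hM p v).1 (hg p v hv),
    M.primrec₂_approxWord⟩

end Computable

/-! ## Symbolic computations of generalized Turing machines -/

section Cell

variable {A : Type u} {Γ : Type}

/-- The approximation of the cells of a generalized Turing machine: a sequence is approximated
by its prefixes, a work symbol only by itself. -/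
def cellApprox (A : Type u) (Γ : Type) : ApproxRel (List A ⊕ Γ) (OmegaWord A ⊕ Γ) :=
  fun n => Sum.LiftRel (ApproxRel.word A n) Eq

/-- The word in a cell; the empty word if the cell contains a work symbol. -/
def cellWord (x : List A ⊕ Γ) : List A := x.elim id fun _ => []

theorem antitone_cellApprox (x : List A ⊕ Γ) (y : OmegaWord A ⊕ Γ) :
    Antitone (cellApprox A Γ · x y) :=
  fun _ _ h => Sum.LiftRel.mono (fun _ _ => ApproxRel.antitone_word _ _ h) fun _ _ => id

theorem word_cellWord {n : ℕ} {x : List A ⊕ Γ} {p : OmegaWord A}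
    (h : cellApprox A Γ n x (Sum.inl p)) : ApproxRel.word A n (cellWord x) p := by
  obtain ⟨h⟩ := h
  exact h

theorem eq_inr_iff_of_cellApprox {n : ℕ} {x : List A ⊕ Γ} {y : OmegaWord A ⊕ Γ}
    (h : cellApprox A Γ n x y) (a : Γ) : x = Sum.inr a ↔ y = Sum.inr a := by
  obtain h | rfl := h <;> simp

theorem primrec_cellWord [Primcodable A] [Primcodable Γ] :
    Primrec (cellWord : List A ⊕ Γ → List A) :=
  (Primrec.sumCasesOn Primrec.id Primrec.snd.to₂ (Primrec.const []).to₂).of_eq fun x => by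
    cases x <;> rfl

end Cell

namespace GTM

open ApproxRel

variable {A : Type u} [Zero A] [One A] {k L : ℕ} (N : GTM A k L fun _ => OmegaWord A)

/-- A symbolic configuration of `N`: the label, and tapes whose cells contain finite words in
place of sequences. -/
abbrev SymConfig : Type u := N.Label × (Fin (L + 1) → LogTape (List A ⊕ N.Γ))

/-- The approximation of configurations of `N` by symbolic configurations. -/
def configApprox : ApproxRel N.SymConfig N.Config := fun n c κ =>
  c.1 = κ.label ∧ ∀ i, (c.2 i).1 = κ.head i ∧
    ∀ z, cellApprox A N.Γ n ((c.2 i).read (Sum.inr N.blank) z) (κ.tape i z)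

namespace SymConfig

variable {N}

/-- The content of the cell scanned on tape `i`. -/
def scanned (c : N.SymConfig) (i : Fin (L + 1)) : List A ⊕ N.Γ :=
  (c.2 i).read (Sum.inr N.blank) (c.2 i).1

/-- Replace tape `i` by `T` and go to the label `l`. -/
def setTape (i : Fin (L + 1)) (T : LogTape (List A ⊕ N.Γ)) (l : N.Label) (c : N.SymConfig) :
    N.SymConfig :=
  (l, Function.update c.2 i T)

/-- The words scanned on the tapes `arg j`. -/
def args {n : ℕ} (arg : Fin n → Fin (L + 1)) (c : N.SymConfig) : Fin n → List A :=
  fun j => cellWord (c.scanned (arg j))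

end SymConfig

variable {N} {n : ℕ} {c : N.SymConfig} {κ : N.Config}

theorem antitone_configApprox (c : N.SymConfig) (κ : N.Config) :
    Antitone (N.configApprox · c κ) :=
  fun _ _ h hc => ⟨hc.1, fun i => ⟨(hc.2 i).1, fun z => antitone_cellApprox _ _ h ((hc.2 i).2 z)⟩⟩

theorem cellApprox_scanned (h : N.configApprox n c κ) (i : Fin (L + 1)) :
    cellApprox A N.Γ n (c.scanned i) (κ.scanned i) := by
  rw [Config.scanned, ← (h.2 i).1]
  exact (h.2 i).2 _

theorem word_args (h : N.configApprox n c κ) {m : ℕ} {arg : Fin m → Fin (L + 1)}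
    {x : Fin m → OmegaWord A} (hx : ∀ j, κ.scanned (arg j) = Sum.inl (x j)) :
    (word A).tuple n (c.args arg) x :=
  fun j => word_cellWord (hx j ▸ cellApprox_scanned h (arg j))

theorem configApprox_setLabel (h : N.configApprox n c κ) (l : N.Label) :
    N.configApprox n (l, c.2) (κ.setLabel l) :=
  ⟨rfl, h.2⟩

theorem configApprox_setHead (h : N.configApprox n c κ) (i : Fin (L + 1)) {m : Option Turing.Dir}
    {z : ℤ} (hz : ((c.2 i).move m).1 = z) (l : N.Label) :
    N.configApprox n (c.setTape i ((c.2 i).move m) l) ((κ.setHead i z).setLabel l) := by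
  refine ⟨rfl, fun j => ?_⟩
  obtain rfl | hj := eq_or_ne j i
  · simpa [Config.setHead, Config.setLabel, SymConfig.setTape, hz] using (h.2 j).2
  · simpa [Config.setHead, Config.setLabel, SymConfig.setTape, hj] using h.2 j

theorem configApprox_setCell (h : N.configApprox n c κ) (i : Fin (L + 1)) {x : List A ⊕ N.Γ}
    {y : OmegaWord A ⊕ N.Γ} (hxy : cellApprox A N.Γ n x y) (l : N.Label) :
    N.configApprox n (c.setTape i ((c.2 i).write x) l) ((κ.setCell i y).setLabel l) := by
  refine ⟨rfl, fun j => ?_⟩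
  obtain rfl | hj := eq_or_ne j i
  · refine ⟨by simpa [Config.setCell, Config.setLabel, SymConfig.setTape, LogTape.write]
      using (h.2 j).1, fun z => ?_⟩
    simp only [Config.setCell, Config.setLabel, SymConfig.setTape, Function.update_self,
      LogTape.read_write, (h.2 j).1]
    obtain rfl | hz := eq_or_ne z (κ.head j)
    · simpa using hxy
    · simpa [hz] using (h.2 j).2 z
  · simpa [Config.setCell, Config.setLabel, SymConfig.setTape, hj] using h.2 j

/-- `e` realizes the effect of the statement `s`; the value `none` means that the available
prefixes and time are insufficient for carrying out `s`. -/
abbrev RealizesEffect (N : GTM A k L fun _ => OmegaWord A)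
    (s : Stmt A (fun _ : Fin (L + 1) => OmegaWord A) N.Γ N.Label)
    (e : ℕ → N.SymConfig → Option N.SymConfig) : Prop :=
  Realizes N.configApprox N.configApprox.option (fun κ => {κ' | N.Effect κ κ' s}) e

namespace SymConfig

/-- The symbolic effect of moving the head on tape `i`. -/
def move (i : Fin (L + 1)) (m : Turing.Dir) (l : N.Label) (_ : ℕ) (c : N.SymConfig) :
    Option N.SymConfig :=
  some (c.setTape i ((c.2 i).move (some m)) l)

/-- The symbolic effect of writing `a` on tape `i`. -/
def write (i : Fin (L + 1)) (a : N.Γ) (l : N.Label) (_ : ℕ) (c : N.SymConfig) :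
    Option N.SymConfig :=
  some (c.setTape i ((c.2 i).write (Sum.inr a)) l)

open Classical in
/-- The symbolic effect of branching according to whether `a` is scanned on tape `i`. -/
noncomputable def ifSymbol (i : Fin (L + 1)) (a : N.Γ) (l₁ l₂ : N.Label) (_ : ℕ)
    (c : N.SymConfig) : Option N.SymConfig :=
  some (if c.scanned i = Sum.inr a then l₁ else l₂, c.2)

/-- The symbolic effect of an assignment whose function is realized by `Φ`. -/
def assign {m : ℕ} (i : Fin (L + 1)) (arg : Fin m → Fin (L + 1))
    (Φ : ℕ → (Fin m → List A) → List A) (l : N.Label) (t : ℕ) (c : N.SymConfig) :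
    Option N.SymConfig :=
  some (c.setTape i ((c.2 i).write (Sum.inl (Φ t (c.args arg)))) l)

open Classical in
/-- The label at which a test with the value `v` continues. -/
noncomputable def branch (l₁ l₂ : N.Label) (v : List A) : N.Label :=
  if v = [0] then l₁ else l₂

/-- The symbolic effect of a test whose function is realized by `Ψ`. -/
noncomputable def test {m : ℕ} (arg : Fin m → Fin (L + 1))
    (Ψ : ℕ → (Fin m → List A) → Option (List A)) (l₁ l₂ : N.Label) (t : ℕ) (c : N.SymConfig) :
    Option N.SymConfig :=
  (Ψ t (c.args arg)).map fun v => (branch l₁ l₂ v, c.2)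

end SymConfig

theorem realizes_move (i : Fin (L + 1)) (m : Turing.Dir) (l : N.Label) {f : ℤ → ℤ}
    (hf : ∀ T : LogTape (List A ⊕ N.Γ), (T.move (some m)).1 = f T.1) :
    Realizes N.configApprox N.configApprox.option
      (fun κ => {(κ.setHead i (f (κ.head i))).setLabel l}) (SymConfig.move i m l) := by
  refine .of_forall_precision (antitone_option antitone_configApprox) ?_
  rintro n κ _ rfl c hc
  exact configApprox_setHead hc i (by rw [hf, (hc.2 i).1]) l

theorem realizesEffect_right (i : Fin (L + 1)) (l : N.Label) :
    N.RealizesEffect (.right i l) (SymConfig.move i .right l) :=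
  realizes_move (f := (· + 1)) i .right l fun _ => rfl

theorem realizesEffect_left (i : Fin (L + 1)) (l : N.Label) :
    N.RealizesEffect (.left i l) (SymConfig.move i .left l) :=
  realizes_move (f := (· - 1)) i .left l fun _ => rfl

theorem realizesEffect_write (i : Fin (L + 1)) (a : N.Γ) (l : N.Label) :
    N.RealizesEffect (.write i a l) (SymConfig.write i a l) := by
  refine .of_forall_precision (antitone_option antitone_configApprox) ?_
  rintro n κ _ rfl c hc
  exact configApprox_setCell hc i (.inr rfl) l

theorem realizesEffect_ifSymbol (i : Fin (L + 1)) (a : N.Γ) (l₁ l₂ : N.Label) :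
    N.RealizesEffect (.ifSymbol i a l₁ l₂) (SymConfig.ifSymbol i a l₁ l₂) := by
  refine .of_forall_precision (antitone_option antitone_configApprox) fun n κ κ' hκ' c hc => ?_
  have hscan : c.scanned i = Sum.inr a ↔ κ.scanned i = Sum.inr a :=
    eq_inr_iff_of_cellApprox (cellApprox_scanned hc i) a
  obtain ⟨ha, rfl⟩ | ⟨ha, rfl⟩ := hκ'
  · rw [if_pos (hscan.2 ha)]
    exact configApprox_setLabel hc l₁
  · rw [if_neg (mt hscan.1 ha)]
    exact configApprox_setLabel hc l₂

theorem realizesEffect_assign {m : ℕ} (i : Fin (L + 1)) (arg : Fin m → Fin (L + 1))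
    {f : MultiFun (Fin m → OmegaWord A) (OmegaWord A)} {Φ : ℕ → (Fin m → List A) → List A}
    (hΦ : Realizes (word A).tuple (word A) f Φ) (l : N.Label) :
    N.RealizesEffect (.assign i m arg f l) (SymConfig.assign i arg Φ l) where
  sound := by
    rintro κ _ ⟨x, hx, y, hy, rfl⟩ t c hc
    exact configApprox_setCell hc i (.inl (hΦ.sound x y hy t _ (word_args hc hx))) l
  complete := by
    rintro κ _ ⟨x, hx, y, hy, rfl⟩ j
    filter_upwards [hΦ.complete x y hy j, eventually_ge_atTop j] with n hn hjn t ht c hc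
    exact configApprox_setCell (antitone_configApprox _ _ hjn hc) i
      (.inl (hn t ht _ (word_args hc hx))) l

theorem realizesEffect_test [NeZero (1 : A)] {m : ℕ} (arg : Fin m → Fin (L + 1))
    {f : (Fin m → OmegaWord A) →. FinWord A}
    (hf : ∀ x, ∀ w ∈ f x, w = ([0] : List A) ∨ w = ([1] : List A))
    {Ψ : ℕ → (Fin m → List A) → Option (List A)}
    (hΨ : Realizes (word A).tuple (discrete (List A)).option (MultiFun.ofPFun f) Ψ)
    (l₁ l₂ : N.Label) :
    N.RealizesEffect (.test m arg f hf l₁ l₂) (SymConfig.test arg Ψ l₁ l₂) := by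
  have hbranch {κ κ' : N.Config} (h : N.Effect κ κ' (.test m arg f hf l₁ l₂)) :
      ∃ x : Fin m → OmegaWord A, (∀ j, κ.scanned (arg j) = Sum.inl (x j)) ∧ ∃ v ∈ f x,
        ∀ n (c : N.SymConfig), N.configApprox n c κ →
          N.configApprox n (SymConfig.branch l₁ l₂ v, c.2) κ' := by
    obtain ⟨x, hx, ⟨hv, rfl⟩ | ⟨hv, rfl⟩⟩ := h
    · refine ⟨x, hx, _, hv, fun n c hc => ?_⟩
      rw [SymConfig.branch, if_pos rfl]
      exact configApprox_setLabel hc l₁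
    · refine ⟨x, hx, _, hv, fun n c hc => ?_⟩
      rw [SymConfig.branch, if_neg (by simp)]
      exact configApprox_setLabel hc l₂
  constructor
  · intro κ κ' hκ t c hc
    obtain ⟨x, hx, v, hv, hκ'⟩ := hbranch hκ
    have hΨv := hΨ.sound x v hv t _ (word_args hc hx)
    unfold SymConfig.test
    cases hu : Ψ t (c.args arg) with
    | none => rfl
    | some u =>
      rw [hu] at hΨv
      obtain rfl : u = v := hΨv
      exact hκ' 0 c hc
  · intro κ κ' hκ j
    obtain ⟨x, hx, v, hv, hκ'⟩ := hbranch hκ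
    filter_upwards [hΨ.complete x v hv 1, eventually_ge_atTop j] with n hn hjn t ht c hc
    obtain ⟨_, hu, rfl⟩ := exists_eq_some_of_option one_ne_zero (hn t ht _ (word_args hc hx))
    rw [SymConfig.test, hu]
    exact antitone_configApprox _ _ hjn (hκ' n c hc)

theorem exists_realizesEffect_of_isContinuous [NeZero (1 : A)]
    {s : Stmt A (fun _ : Fin (L + 1) => OmegaWord A) N.Γ N.Label} (hs : s.IsContinuous) :
    ∃ e, N.RealizesEffect s e := by
  cases s with
  | right i l => exact ⟨_, realizesEffect_right i l⟩
  | left i l => exact ⟨_, realizesEffect_left i l⟩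
  | write i a l => exact ⟨_, realizesEffect_write i a l⟩
  | ifSymbol i a l₁ l₂ => exact ⟨_, realizesEffect_ifSymbol i a l₁ l₂⟩
  | assign i m arg f l =>
    obtain ⟨g, rfl, hg⟩ := hs
    obtain ⟨Φ, hΦ⟩ := hg.exists_realizes_word
    exact ⟨_, realizesEffect_assign i arg hΦ l⟩
  | test m arg f hf l₁ l₂ =>
    obtain ⟨Ψ, hΨ⟩ := PFunContinuous.exists_realizes_discrete hs
    exact ⟨_, realizesEffect_test arg hf hΨ l₁ l₂⟩

section Primrec

variable [Primcodable A] [Primcodable N.Γ] [Primcodable N.Label]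

namespace SymConfig

theorem primrec_tape (i : Fin (L + 1)) : Primrec fun x : ℕ × N.SymConfig => x.2.2 i :=
  primrec_pi_apply (Primrec.snd.comp Primrec.snd) i

theorem primrec_scanned (i : Fin (L + 1)) : Primrec fun c : N.SymConfig => c.scanned i :=
  have htape : Primrec fun c : N.SymConfig => c.2 i := primrec_pi_apply Primrec.snd i
  (LogTape.primrec_read _).comp htape (Primrec.fst.comp htape)

theorem primrec_args {n : ℕ} (arg : Fin n → Fin (L + 1)) :
    Primrec fun c : N.SymConfig => c.args arg :=
  primrec_pi_mk fun j => primrec_cellWord.comp (primrec_scanned (arg j))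

theorem primrec₂_setTape (i : Fin (L + 1)) {T : ℕ × N.SymConfig → LogTape (List A ⊕ N.Γ)}
    (hT : Primrec T) (l : N.Label) :
    Primrec₂ fun (t : ℕ) (c : N.SymConfig) => some (c.setTape i (T (t, c)) l) :=
  Primrec.option_some.comp (Primrec.pair (Primrec.const l)
    (primrec_pi_update (Primrec.snd.comp Primrec.snd) hT i))

theorem primrec₂_move (i : Fin (L + 1)) (m : Turing.Dir) (l : N.Label) :
    Primrec₂ (move i m l : ℕ → N.SymConfig → _) :=
  primrec₂_setTape i ((LogTape.primrec_move _).comp (primrec_tape i)) l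

theorem primrec₂_write (i : Fin (L + 1)) (a : N.Γ) (l : N.Label) :
    Primrec₂ (write i a l : ℕ → N.SymConfig → _) :=
  primrec₂_setTape i (LogTape.primrec_write.comp (Primrec.const _) (primrec_tape i)) l

theorem primrec₂_ifSymbol (i : Fin (L + 1)) (a : N.Γ) (l₁ l₂ : N.Label) :
    Primrec₂ (ifSymbol i a l₁ l₂ : ℕ → N.SymConfig → _) := by
  classical
  exact Primrec.option_some.comp (Primrec.pair
    (Primrec.ite (Primrec.eq.comp ((primrec_scanned i).comp Primrec.snd) (Primrec.const _))
      (Primrec.const _) (Primrec.const _)) (Primrec.snd.comp Primrec.snd))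

theorem primrec₂_assign {m : ℕ} (i : Fin (L + 1)) (arg : Fin m → Fin (L + 1))
    {Φ : ℕ → (Fin m → List A) → List A} (hΦ : Primrec₂ Φ) (l : N.Label) :
    Primrec₂ (assign i arg Φ l : ℕ → N.SymConfig → _) :=
  primrec₂_setTape i (LogTape.primrec_write.comp
    (Primrec.sumInl.comp (hΦ.comp Primrec.fst ((primrec_args arg).comp Primrec.snd)))
    (primrec_tape i)) l

theorem primrec₂_test {m : ℕ} (arg : Fin m → Fin (L + 1))
    {Ψ : ℕ → (Fin m → List A) → Option (List A)} (hΨ : Primrec₂ Ψ) (l₁ l₂ : N.Label) :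
    Primrec₂ (test arg Ψ l₁ l₂ : ℕ → N.SymConfig → _) := by
  classical
  have hbranch : Primrec (branch l₁ l₂ : List A → N.Label) :=
    Primrec.ite (Primrec.eq.comp Primrec.id (Primrec.const _)) (Primrec.const _) (Primrec.const _)
  exact Primrec.option_map (hΨ.comp Primrec.fst ((primrec_args arg).comp Primrec.snd))
    (Primrec.pair (hbranch.comp Primrec.snd) (Primrec.snd.comp (Primrec.snd.comp Primrec.fst)))

end SymConfig

theorem exists_realizesEffect_of_isComputable [Finite A] [NeZero (1 : A)]
    {s : Stmt A (fun _ : Fin (L + 1) => OmegaWord A) N.Γ N.Label} (hs : s.IsComputable) :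
    ∃ e, N.RealizesEffect s e ∧ Primrec₂ e := by
  cases s with
  | right i l => exact ⟨_, realizesEffect_right i l, SymConfig.primrec₂_move i .right l⟩
  | left i l => exact ⟨_, realizesEffect_left i l, SymConfig.primrec₂_move i .left l⟩
  | write i a l => exact ⟨_, realizesEffect_write i a l, SymConfig.primrec₂_write i a l⟩
  | ifSymbol i a l₁ l₂ =>
    exact ⟨_, realizesEffect_ifSymbol i a l₁ l₂, SymConfig.primrec₂_ifSymbol i a l₁ l₂⟩
  | assign i m arg f l =>
    obtain ⟨g, rfl, hg⟩ := hs
    obtain ⟨Φ, hΦ, hprimrec⟩ := hg.exists_realizes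
    exact ⟨_, realizesEffect_assign i arg hΦ l, SymConfig.primrec₂_assign i arg hprimrec l⟩
  | test m arg f hf l₁ l₂ =>
    obtain ⟨Ψ, hΨ, hprimrec⟩ := ComputableWord.exists_realizes hs
    exact ⟨_, realizesEffect_test arg hf hΨ l₁ l₂, SymConfig.primrec₂_test arg hprimrec l₁ l₂⟩

end Primrec

section Simulation

variable (N) in
/-- The successor relation as a multi-function, with a configuration at the final label as its
own successor. Thus accepting computations become infinite sequences. -/
def stutter : MultiFun N.Config N.Config :=
  fun κ => {κ' | N.Succ κ κ' ∨ κ.label = N.final ∧ κ' = κ}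

open Classical in
/-- The symbolic form of `GTM.stutter`, for effects `E l` realizing the statements of `N`. -/
noncomputable def symStep (E : {l : N.Label // l ≠ N.final} → ℕ → N.SymConfig → Option N.SymConfig)
    (t : ℕ) (c : N.SymConfig) : Option N.SymConfig :=
  if h : c.1 = N.final then some c else E ⟨c.1, h⟩ t c

variable {E : {l : N.Label // l ≠ N.final} → ℕ → N.SymConfig → Option N.SymConfig}

theorem realizes_symStep (hE : ∀ l, N.RealizesEffect (N.stm l) (E l)) :
    Realizes N.configApprox N.configApprox.option N.stutter (symStep E) where
  sound := by
    rintro κ κ' (⟨hfinal, heffect⟩ | ⟨hfinal, rfl⟩) t ⟨l, T⟩ hc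
    · obtain rfl : l = κ.label := hc.1
      rw [symStep, dif_neg hfinal]
      exact (hE _).sound κ κ' heffect t _ hc
    · rw [symStep, dif_pos (hc.1.trans hfinal)]
      exact hc
  complete := by
    rintro κ κ' (⟨hfinal, heffect⟩ | ⟨hfinal, rfl⟩) j
    · filter_upwards [(hE _).complete κ κ' heffect j] with n hn
      rintro t ht ⟨l, T⟩ hc
      obtain rfl : l = κ.label := hc.1
      rw [symStep, dif_neg hfinal]
      exact hn t ht _ hc
    · filter_upwards [eventually_ge_atTop j] with n hn t _ c hc
      rw [symStep, dif_pos (hc.1.trans hfinal)]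
      exact antitone_configApprox _ _ hn hc

theorem exists_path_of_mem_multiFun {p : Fin k → OmegaWord A} {q : OmegaWord A}
    (hq : q ∈ N.multiFun p) :
    ∃ κ : ℕ → N.Config, κ 0 = N.initialConfig p ∧ (∀ m, κ (m + 1) ∈ N.stutter (κ m)) ∧
      (∀ m, (κ m).label = N.final → (κ m).tape 0 0 = Sum.inl q) ∧
      ∃ m, (κ m).label = N.final := by
  obtain ⟨-, n, κ, hκ, hinit, ⟨hfinal, -⟩, hq⟩ := hq
  let path (m : ℕ) : N.Config := κ ⟨min m n, Nat.lt_succ_of_le (min_le_right m n)⟩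
  have hstep {m : ℕ} (hm : m < n) : N.Succ (path m) (path (m + 1)) := by
    have h := hκ ⟨m, hm⟩
    simp only [path, min_eq_left hm.le, min_eq_left (Nat.succ_le_of_lt hm)]
    exact h
  have hlast {m : ℕ} (hm : n ≤ m) : path m = κ (Fin.last n) := by
    simp only [path, min_eq_right hm]
    rfl
  refine ⟨path, hinit, fun m => ?_, fun m hm => ?_, n, by rwa [hlast le_rfl]⟩
  · obtain hm | hm := lt_or_ge m n
    · exact .inl (hstep hm)
    · exact .inr ⟨by rwa [hlast hm], by rw [hlast hm, hlast (hm.trans m.le_succ)]⟩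
  · obtain hmn | hmn := lt_or_ge m n
    · exact absurd hm (hstep hmn).1
    · rwa [hlast hmn]

/-- The initial symbolic configuration for the words `w` on the input tapes. -/
def symInit (N : GTM A k L fun _ => OmegaWord A) (w : Fin k → List A) : N.SymConfig :=
  (N.initial, fun i => (0, Fin.cases [] (fun i =>
    if h : i.val < k then [(0, Sum.inl (w ⟨i.val, h⟩))] else []) i))

theorem configApprox_symInit {w : Fin k → List A} {p : Fin k → OmegaWord A}
    (h : (word A).tuple n w p) : N.configApprox n (symInit N w) (N.initialConfig p) := by
  refine ⟨rfl, fun i => ⟨rfl, fun z => ?_⟩⟩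
  induction i using Fin.cases with
  | zero => exact .inr rfl
  | succ i =>
    simp only [symInit, initialConfig, LogTape.read, Fin.cases_succ]
    by_cases hi : i.val < k
    · obtain rfl | hz := eq_or_ne z 0
      · simpa [hi, cellApprox] using h _
      · simp [hi, hz, List.lookup_cons, beq_eq_false_iff_ne.2 hz, cellApprox]
    · simp [hi, cellApprox]

/-- The word in cell `0` of tape `0`. -/
def symOutput (c : N.SymConfig) : List A := cellWord ((c.2 0).read (Sum.inr N.blank) 0)

open Classical in
/-- The output of a symbolic configuration at the final label, and otherwise the empty word. -/
noncomputable def symResult (c : Option N.SymConfig) : List A :=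
  c.elim [] fun c => if c.1 = N.final then symOutput c else []

theorem word_symOutput (h : N.configApprox n c κ) {q : OmegaWord A}
    (hq : κ.tape 0 0 = Sum.inl q) : word A n (symOutput c) q :=
  word_cellWord (hq ▸ (h.2 0).2 0)

/-- The result of `t` symbolic steps of `N` on the words `w`. -/
noncomputable def symRun (E : {l : N.Label // l ≠ N.final} → ℕ → N.SymConfig → Option N.SymConfig)
    (t : ℕ) (w : Fin k → List A) : List A :=
  symResult ((fun c => c.bind (symStep E t))^[t] (some (symInit N w)))

theorem iterate_symStep_of_eq_final (t : ℕ) {c : N.SymConfig} (hc : c.1 = N.final) (m : ℕ) :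
    (fun c => c.bind (symStep E t))^[m] (some c) = some c :=
  Function.iterate_fixed (by rw [Option.bind_some, symStep, dif_pos hc]) m

theorem realizes_symRun (hE : ∀ l, N.RealizesEffect (N.stm l) (E l)) :
    Realizes (word A).tuple (word A) N.multiFun (symRun E) := by
  have hstep := (realizes_symStep hE).option_bind
  constructor
  · intro p q hq t w hw
    obtain ⟨κ, hinit, hpath, hresult, -⟩ := exists_path_of_mem_multiFun hq
    have hrun := hstep.sound_iterate hpath (t := t) (d := some (symInit N w))
      (hinit ▸ configApprox_symInit hw) t
    rw [symRun]
    cases hc : (fun c => c.bind (symStep E t))^[t] (some (symInit N w)) with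
    | none => exact word_zero_iff.2 (isPrefix_nil q)
    | some c =>
      rw [hc] at hrun
      rw [symResult, Option.elim_some]
      split_ifs with hfinal
      · exact word_symOutput hrun (hresult t (hrun.1.symm.trans hfinal))
      · exact word_zero_iff.2 (isPrefix_nil q)
  · intro p q hq j
    obtain ⟨κ, hinit, hpath, hresult, m, hm⟩ := exists_path_of_mem_multiFun hq
    filter_upwards [hstep.complete_iterate (antitone_option antitone_configApprox) hpath m
      (max j 1), eventually_ge_atTop m] with n hn hmn t ht w hw
    obtain ⟨c, hc, happrox⟩ := exists_eq_some_of_option (by omega)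
      (hn t ht (some (symInit N w)) (hinit ▸ configApprox_symInit hw))
    have hfinal : c.1 = N.final := happrox.1.trans hm
    obtain ⟨r, rfl⟩ := Nat.exists_eq_add_of_le' (hmn.trans ht)
    rw [symRun, Function.iterate_add_apply, hc, iterate_symStep_of_eq_final _ hfinal, symResult,
      Option.elim_some, if_pos hfinal]
    exact antitone_word _ _ (le_max_left j 1) (word_symOutput happrox (hresult m hm))

section Primrec

variable [Primcodable A] [Primcodable N.Γ] [Primcodable N.Label]

theorem primrec_symInit : Primrec (symInit N) := by
  refine Primrec.pair (Primrec.const _) (primrec_pi_mk fun i => Primrec.pair (Primrec.const _) ?_)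
  induction i using Fin.cases with
  | zero => exact Primrec.const _
  | succ i =>
    by_cases hi : i.val < k
    · simp only [Fin.cases_succ, hi, dif_pos]
      exact Primrec.list_cons.comp (Primrec.pair (Primrec.const _)
        (Primrec.sumInl.comp (primrec_pi_apply Primrec.id _))) (Primrec.const _)
    · simp only [Fin.cases_succ, hi, dif_neg, not_false_eq_true]
      exact Primrec.const _

theorem primrec₂_symStep (hE : ∀ l, Primrec₂ (E l)) : Primrec₂ (symStep E) := by
  have h : Primrec₂ fun (l : N.Label) (x : ℕ × N.SymConfig) =>
      open Classical in if h : l = N.final then some x.2 else E ⟨l, h⟩ x.1 x.2 :=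
    primrec₂_of_finite fun l => by
      by_cases hl : l = N.final
      · simpa only [hl, dite_true] using Primrec.option_some.comp Primrec.snd
      · simp only [hl, dite_false]
        exact hE ⟨l, hl⟩
  exact h.comp (Primrec.fst.comp Primrec.snd) Primrec.id

theorem primrec_symResult : Primrec (symResult : Option N.SymConfig → List A) := by
  classical
  have houtput : Primrec (symOutput : N.SymConfig → List A) :=
    primrec_cellWord.comp ((LogTape.primrec_read _).comp (primrec_pi_apply Primrec.snd 0)
      (Primrec.const 0))
  exact (Primrec.option_casesOn Primrec.id (Primrec.const [])
    (Primrec.ite (Primrec.eq.comp (Primrec.fst.comp Primrec.snd) (Primrec.const _))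
      (houtput.comp Primrec.snd) (Primrec.const [])).to₂).of_eq fun c => by cases c <;> rfl

theorem primrec₂_symRun (hE : ∀ l, Primrec₂ (E l)) :
    Primrec₂ (symRun E : ℕ → (Fin k → List A) → List A) :=
  primrec_symResult.comp (Primrec.nat_iterate Primrec.fst
    (Primrec.option_some.comp (primrec_symInit.comp Primrec.snd))
    (Primrec.option_bind Primrec.snd ((primrec₂_symStep hE).comp
      (Primrec.fst.comp (Primrec.fst.comp Primrec.fst)) Primrec.snd)))

end Primrec

end Simulation

end GTM

/-! ## Machines with stacks -/

section StackMachine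

open Turing

variable {α : Type*} [Inhabited α]

theorem tape_head_mk₁ (l : List α) : (Tape.mk₁ l).head = l.headI := rfl

theorem tape_write_mk₁ (a : α) (l : List α) :
    (Tape.mk₁ l).write a = Tape.mk₁ (a :: l.tail) := by
  rw [Tape.mk₁, Tape.mk₂, ← ListBlank.cons_head_tail (ListBlank.mk l), Tape.write_mk',
    ListBlank.tail_mk, ListBlank.cons_mk]
  rfl

theorem tape_move_left_mk₁ (l : List α) :
    (Tape.mk₁ l).move Dir.left = Tape.mk₁ (default :: l) := by
  rw [Tape.mk₁, Tape.mk₂, Tape.move_left_mk', ListBlank.cons_mk]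
  rfl

theorem tape_move_right_mk₁_default_cons (l : List α) :
    (Tape.mk₁ (default :: l)).move Dir.right = Tape.mk₁ l := by
  rw [← tape_move_left_mk₁, Tape.move_left_right]

/-- The operations on a stack that is kept on a work tape, where the head scans the top and unused
cells hold `none`. A Turing machine writes before it moves, hence pushing a symbol takes two
operations, `pushBlank` and `setTop`. -/
inductive StackOp (Γ : Type)
  | nop
  | pushBlank
  | pop
  | setTop (a : Γ)

namespace StackOp

variable {Γ : Type}

/-- The effect of an operation on the contents of the stack. -/
def apply : StackOp Γ → List (Option Γ) → List (Option Γ)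
  | nop, l => l
  | pushBlank, l => none :: l
  | pop, l => l.tail
  | setTop a, l => some a :: l.tail

/-- The action on the work tape that performs an operation, if `h` is the scanned symbol. -/
def action (h : Option Γ) : StackOp Γ → Option Γ × Option Dir
  | nop => (h, none)
  | pushBlank => (h, some Dir.left)
  | pop => (none, some Dir.right)
  | setTop a => (some a, none)

@[simp] theorem apply_nop (l : List (Option Γ)) : nop.apply l = l := rfl

@[simp] theorem apply_pushBlank (l : List (Option Γ)) : pushBlank.apply l = none :: l := rfl

@[simp] theorem apply_pop (l : List (Option Γ)) : pop.apply l = l.tail := rfl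

@[simp] theorem apply_setTop (a : Γ) (l : List (Option Γ)) :
    (setTop a).apply l = some a :: l.tail := rfl

theorem actWork_action (o : StackOp Γ) (l : List (Option Γ)) :
    TypeTwoMachine.actWork (o.action l.headI) (Tape.mk₁ l) = Tape.mk₁ (o.apply l) := by
  cases o with
  | nop => exact Tape.write_self (Tape.mk₁ l)
  | pushBlank =>
    exact (congrArg (Tape.move Dir.left) (Tape.write_self (Tape.mk₁ l))).trans
      (tape_move_left_mk₁ l)
  | pop =>
    exact (congrArg (Tape.move Dir.right) (tape_write_mk₁ none l)).trans
      (tape_move_right_mk₁_default_cons l.tail)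
  | setTop a => exact tape_write_mk₁ (some a) l

end StackOp

/-- A machine that reads columns of `k` input symbols, with all input heads moving together, and
has stacks indexed by `K`. Depending on the control state, the scanned column and the tops of the
stacks, it passes to a new control state, possibly moves the input heads on, performs an operation
on each stack, and appends at most one symbol to the output. -/
structure StackMachine (A : Type u) (k : ℕ) (K Γ : Type) where
  State : Type
  start : State
  next : State → (Fin k → A) → (K → Option Γ) → State × Bool × (K → StackOp Γ) × Option A

namespace StackMachine

variable {A : Type u} {k : ℕ} {K Γ : Type}

/-- A configuration: the control state, the common position of the input heads, the contents of
the stacks, and the output. -/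
structure Config (M : StackMachine A k K Γ) where
  state : M.State
  pos : ℕ
  stack : K → List (Option Γ)
  out : List A

variable (M : StackMachine A k K Γ) (p : Fin k → OmegaWord A)

/-- The initial configuration. -/
def init : M.Config := ⟨M.start, 0, fun _ => [], []⟩

/-- One step on input `p`. -/
def step (x : M.Config) : M.Config :=
  let r := M.next x.state (fun i => p i x.pos) fun i => (x.stack i).headI
  ⟨r.1, bif r.2.1 then x.pos + 1 else x.pos, fun i => (r.2.2.1 i).apply (x.stack i),
    x.out ++ r.2.2.2.toList⟩

/-- The configuration `y` is reached from `x` on input `p`. -/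
def Reaches : M.Config → M.Config → Prop := Relation.ReflTransGen fun x y => M.step p x = y

variable {M p}

theorem Reaches.refl (x : M.Config) : M.Reaches p x x := Relation.ReflTransGen.refl

theorem Reaches.trans {x y z : M.Config} (h : M.Reaches p x y) (h' : M.Reaches p y z) :
    M.Reaches p x z := Relation.ReflTransGen.trans h h'

theorem Reaches.head {x y : M.Config} (h : M.Reaches p (M.step p x) y) : M.Reaches p x y :=
  Relation.ReflTransGen.head rfl h

theorem Reaches.of_step_eq {x y : M.Config} (h : M.step p x = y) : M.Reaches p x y :=
  Relation.ReflTransGen.single h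

section Simulation

variable [Finite K] [Finite Γ] {S : Set M.State} [Finite S] {hstart : M.start ∈ S}
  {hnext : ∀ s ∈ S, ∀ a h, (M.next s a h).1 ∈ S}

/-- The Type-2 machine that keeps each stack on a work tape, where `S` is a finite set of control
states that contains all control states that occur. -/
noncomputable def toTypeTwoMachine (hstart : M.start ∈ S)
    (hnext : ∀ s ∈ S, ∀ a h, (M.next s a h).1 ∈ S) : TypeTwoMachine A k where
  State := S
  start := ⟨M.start, hstart⟩
  workTapes := Nat.card K
  Work := Option Γ
  next s a h :=
    let r := M.next s a fun i => h (Finite.equivFin K i)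
    some (⟨r.1, hnext s s.2 _ _⟩, fun _ => bif r.2.1 then some Dir.right else none,
      fun j => (r.2.2.1 ((Finite.equivFin K).symm j)).action (h j), r.2.2.2)

/-- A configuration of the Type-2 machine that stands for a configuration of the stack machine. -/
structure Represents (c : (toTypeTwoMachine hstart hnext).Config) (x : M.Config) : Prop where
  state : c.state.1 = x.state
  inputHead : ∀ i, c.inputHead i = x.pos
  work : ∀ j, c.work j = Tape.mk₁ (x.stack ((Finite.equivFin K).symm j))
  out : c.out = x.out

theorem represents_init :
    Represents (toTypeTwoMachine hstart hnext).init M.init :=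
  ⟨rfl, fun _ => rfl, fun _ => rfl, rfl⟩

theorem Represents.exists_step {c : (toTypeTwoMachine hstart hnext).Config} {x : M.Config}
    (h : Represents c x) :
    ∃ c', (toTypeTwoMachine hstart hnext).step p c = some c' ∧ Represents c' (M.step p x) := by
  obtain ⟨s, pos, T, o⟩ := x
  obtain ⟨s, i, W, o'⟩ := c
  obtain ⟨rfl, hi, hW, rfl⟩ := h
  obtain rfl : i = fun _ => pos := funext hi
  obtain rfl : W = fun j => Tape.mk₁ (T ((Finite.equivFin K).symm j)) := funext hW
  refine ⟨_, rfl, ?_, fun i => ?_, fun j => ?_, ?_⟩ <;>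
    simp only [toTypeTwoMachine, step, tape_head_mk₁, Equiv.symm_apply_apply]
  · cases (M.next s.1 (fun i => p i pos) fun i => (T i).headI).2.1 <;> rfl
  · exact StackOp.actWork_action _ _

theorem exists_run_eq_some (n : ℕ) :
    ∃ c x, (toTypeTwoMachine hstart hnext).run p n = some c ∧ Represents c x := by
  induction n with
  | zero => exact ⟨_, _, rfl, represents_init⟩
  | succ n ih =>
    obtain ⟨c, x, hc, h⟩ := ih
    obtain ⟨c', hc', h'⟩ := h.exists_step (p := p)
    exact ⟨c', _, by rw [TypeTwoMachine.run, hc, Option.bind_some, hc'], h'⟩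

theorem exists_run_of_reaches {x : M.Config} (h : M.Reaches p M.init x) :
    ∃ n c, (toTypeTwoMachine hstart hnext).run p n = some c ∧ Represents c x := by
  induction h with
  | refl => exact ⟨0, _, rfl, represents_init⟩
  | tail _ hstep ih =>
    obtain ⟨n, c, hc, h⟩ := ih
    obtain ⟨c', hc', h'⟩ := h.exists_step (p := p)
    exact ⟨n + 1, c', by rw [TypeTwoMachine.run, hc, Option.bind_some, hc'], hstep ▸ h'⟩

end Simulation

theorem exists_typeTwoMachine [Finite K] [Finite Γ] {S : Set M.State} (hS : S.Finite)
    (hstart : M.start ∈ S) (hnext : ∀ s ∈ S, ∀ a h, (M.next s a h).1 ∈ S) :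
    ∃ M' : TypeTwoMachine A k, ∀ p, (∀ n, ∃ c, M'.run p n = some c) ∧
      ∀ x, M.Reaches p M.init x → ∃ n c, M'.run p n = some c ∧ c.out = x.out := by
  have := hS.to_subtype
  refine ⟨toTypeTwoMachine hstart hnext, fun p => ⟨fun n => ?_, fun x hx => ?_⟩⟩
  · obtain ⟨c, -, hc, -⟩ := exists_run_eq_some (hstart := hstart) (hnext := hnext) (p := p) n
    exact ⟨c, hc⟩
  · obtain ⟨n, c, hc, h⟩ := exists_run_of_reaches (hstart := hstart) (hnext := hnext) hx
    exact ⟨n, c, hc, h.out⟩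

end StackMachine

end StackMachine

/-! ## Stack programs that are run in a loop -/

section StackLoop

open Turing Turing.PartrecToTM2

instance finite_K' : Finite K' :=
  Finite.of_surjective (fun i : Fin 4 => ![K'.main, K'.rev, K'.aux, K'.stack] i)
    (by rintro (_ | _ | _ | _); exacts [⟨0, rfl⟩, ⟨1, rfl⟩, ⟨2, rfl⟩, ⟨3, rfl⟩])

/-- The statements of a program on the stacks of `Turing.PartrecToTM2`. -/
abbrev StackStmt (Λ σ : Type) := TM2.Stmt (fun _ : K' => Γ') Λ σ

/-- A stack program that is run in a loop. In each round, a column of input symbols is read, the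
statement `load` for this column is executed, and the program `tr` is run until it halts; then a
word is popped from the main stack up to its end marker and is translated into at most one output
symbol by `dec`. Since only finitely many control states are available, the words must not be longer
than `bound`. -/
structure StackLoop (A : Type u) (k : ℕ) where
  Λ : Type
  σ : Type
  [finiteVar : Finite σ]
  tr : Λ → StackStmt Λ σ
  load : (Fin k → A) → StackStmt Λ σ
  v₀ : σ
  dec : List Γ' → Option A
  bound : ℕ
  support : Finset Λ
  support_tr : ∀ l ∈ support, TM2.SupportsStmt support (tr l)
  support_load : ∀ a, TM2.SupportsStmt support (load a)

namespace StackLoop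

attribute [instance] finiteVar

/-- The control states of a loop: the state in which a first code of `0` is pushed, the state in
which a column is read, the states in which a statement is executed, the states in the middle of
pushing a symbol, and the states in which the result `l` of a round has been popped. -/
inductive State (Λ σ : Type)
  | start
  | read
  | exec (q : StackStmt Λ σ) (v : σ)
  | push (i : K') (a : Γ') (q : StackStmt Λ σ) (v : σ)
  | post (l : List Γ')

variable {A : Type u} {k : ℕ} (P : StackLoop A k)

/-- Perform `o` on the stack `i`. -/
def only (i : K') (o : StackOp Γ') : K' → StackOp Γ' := Function.update (fun _ => .nop) i o

/-- The transition function of the stack machine that performs the loop. -/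
def next : State P.Λ P.σ → (Fin k → A) → (K' → Option Γ') →
    State P.Λ P.σ × Bool × (K' → StackOp Γ') × Option A
  | .start, _, _ => (.read, false, only .main (.setTop Γ'.cons), none)
  | .read, a, _ => (.exec (P.load a) P.v₀, true, fun _ => .nop, none)
  | .exec (.push i f q) v, _, _ => (.push i (f v) q v, false, only i .pushBlank, none)
  | .exec (.peek i f q) v, _, h => (.exec q (f v (h i)), false, fun _ => .nop, none)
  | .exec (.pop i f q) v, _, h => (.exec q (f v (h i)), false, only i .pop, none)
  | .exec (.load f q) v, _, _ => (.exec q (f v), false, fun _ => .nop, none)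
  | .exec (.branch f q₁ q₂) v, _, _ => (.exec (cond (f v) q₁ q₂) v, false, fun _ => .nop, none)
  | .exec (.goto f) v, _, _ => (.exec (P.tr (f v)) v, false, fun _ => .nop, none)
  | .exec .halt _, _, _ => (.post [], false, fun _ => .nop, none)
  | .push i a q v, _, _ => (.exec q v, false, only i (.setTop a), none)
  | .post l, _, h =>
    match h .main with
    | none => (.read, false, fun _ => .nop, none)
    | some x =>
      if natEnd x then (.read, false, only .main .pop, P.dec l)
      else if l.length < P.bound then (.post (l ++ [x]), false, only .main .pop, none)
      else (.read, false, fun _ => .nop, none)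

/-- The stack machine that performs the loop. -/
def toStackMachine : StackMachine A k K' Γ' := ⟨State P.Λ P.σ, .start, P.next⟩

/-! ### Finiteness of the set of control states -/

/-- The statements that can occur. -/
def stmts : Set (StackStmt P.Λ P.σ) :=
  (⋃ l ∈ P.support, ↑(TM2.stmts₁ (P.tr l))) ∪ ⋃ a, ↑(TM2.stmts₁ (P.load a))

theorem finite_stmts [Finite A] : P.stmts.Finite :=
  (P.support.finite_toSet.biUnion fun _ _ => Finset.finite_toSet _).union
    (Set.finite_iUnion fun _ => Finset.finite_toSet _)

variable {P}

theorem mem_stmts {q : StackStmt P.Λ P.σ} : q ∈ P.stmts ↔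
    (∃ l ∈ P.support, q ∈ TM2.stmts₁ (P.tr l)) ∨ ∃ a, q ∈ TM2.stmts₁ (P.load a) := by
  simp only [stmts, Set.mem_union, Set.mem_iUnion, Finset.mem_coe, exists_prop]

theorem mem_stmts_of_mem_stmts₁ {q q' : StackStmt P.Λ P.σ} (h : q ∈ P.stmts)
    (h' : q' ∈ TM2.stmts₁ q) : q' ∈ P.stmts :=
  mem_stmts.2 <| (mem_stmts.1 h).imp (fun ⟨l, hl, h⟩ => ⟨l, hl, TM2.stmts₁_trans h h'⟩)
    fun ⟨a, h⟩ => ⟨a, TM2.stmts₁_trans h h'⟩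

theorem supportsStmt_of_mem_stmts {q : StackStmt P.Λ P.σ} (h : q ∈ P.stmts) :
    TM2.SupportsStmt P.support q :=
  (mem_stmts.1 h).elim (fun ⟨l, hl, h⟩ => TM2.stmts₁_supportsStmt_mono h (P.support_tr l hl))
    fun ⟨a, h⟩ => TM2.stmts₁_supportsStmt_mono h (P.support_load a)

variable (P)

/-- The control states that can occur. -/
def states : Set (State P.Λ P.σ) := fun
  | .exec q _ => q ∈ P.stmts
  | .push _ _ q _ => q ∈ P.stmts
  | .post l => l.length ≤ P.bound
  | _ => True

theorem finite_states [Finite A] : P.states.Finite := by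
  have hexec := P.finite_stmts.image2 State.exec (Set.finite_univ (α := P.σ))
  have hpush := P.finite_stmts.image2 (fun q (x : K' × Γ' × P.σ) => State.push x.1 x.2.1 q x.2.2)
    Set.finite_univ
  have hpost := (List.finite_length_le Γ' P.bound).image (State.post (Λ := P.Λ) (σ := P.σ))
  refine ((Set.toFinite {State.start, State.read}).union
    (hexec.union (hpush.union hpost))).subset ?_
  rintro (_ | _ | ⟨q, v⟩ | ⟨i, a, q, v⟩ | l) hs
  · exact .inl (.inl rfl)
  · exact .inl (.inr rfl)
  · exact .inr (.inl ⟨q, hs, v, trivial, rfl⟩)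
  · exact .inr (.inr (.inl ⟨q, hs, (i, a, v), trivial, rfl⟩))
  · exact .inr (.inr (.inr ⟨l, hs, rfl⟩))

theorem start_mem_states : P.toStackMachine.start ∈ P.states := trivial

theorem next_mem_states (s) (hs : s ∈ P.states) (a : Fin k → A) (h : K' → Option Γ') :
    (P.toStackMachine.next s a h).1 ∈ P.states := by
  rcases s with _ | _ | ⟨q, v⟩ | ⟨i, b, q, v⟩ | l
  · trivial
  · exact mem_stmts.2 (.inr ⟨a, TM2.stmts₁_self⟩)
  · have hsub : ∀ q' ∈ TM2.stmts₁ q, q' ∈ P.stmts := fun q' => mem_stmts_of_mem_stmts₁ hs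
    cases q with
    | goto f => exact mem_stmts.2 (.inl ⟨f v, supportsStmt_of_mem_stmts hs v, TM2.stmts₁_self⟩)
    | halt => exact Nat.zero_le _
    | branch f q₁ q₂ =>
      simp only [toStackMachine, next]
      cases f v
      · exact hsub _ (by simp [TM2.stmts₁, TM2.stmts₁_self])
      · exact hsub _ (by simp [TM2.stmts₁, TM2.stmts₁_self])
    | _ => exact hsub _ (by simp [TM2.stmts₁, TM2.stmts₁_self])
  · exact hs
  · simp only [toStackMachine, next]
    split
    · trivial
    · split_ifs with _ hl
      · trivial
      · exact (List.length_append.trans_le hl : (l ++ [_]).length ≤ P.bound)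
      · trivial

/-! ### The course of a round -/

/-- The contents of the stacks of the machine for given stacks of the program. -/
def lists (T : K' → List Γ') : K' → List (Option Γ') := fun i => (T i).map some

theorem lists_def (T : K' → List Γ') : lists T = fun i => (T i).map some := rfl

theorem headI_map_some (l : List Γ') : (l.map some).headI = l.head? := by
  cases l <;> rfl

theorem headI_lists (T : K' → List Γ') (i : K') : (lists T i).headI = (T i).head? :=
  headI_map_some _

theorem apply_only (T : K' → List (Option Γ')) (i : K') (o : StackOp Γ') :
    (fun j => (only i o j).apply (T j)) = Function.update T i (o.apply (T i)) := by
  funext j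
  obtain rfl | h := eq_or_ne j i
  · simp [only]
  · simp [only, h]

theorem update_lists (T : K' → List Γ') (i : K') (l : List Γ') :
    Function.update (lists T) i (l.map some) = lists (Function.update T i l) := by
  funext j
  obtain rfl | h := eq_or_ne j i
  · simp [lists]
  · simp [lists, h]

/-- The configuration of the stack machine for a configuration of the program, when `m` columns have
been read and the output is `o`. -/
def ofCfg (m : ℕ) (o : List A) : TM2.Cfg (fun _ : K' => Γ') P.Λ P.σ → P.toStackMachine.Config
  | ⟨some l, v, T⟩ => ⟨.exec (P.tr l) v, m, lists T, o⟩
  | ⟨none, _, T⟩ => ⟨.post [], m, lists T, o⟩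

variable {P} {p : Fin k → OmegaWord A}

theorem reaches_stepAux (m : ℕ) (o : List A) (q : StackStmt P.Λ P.σ) (v : P.σ)
    (T : K' → List Γ') :
    P.toStackMachine.Reaches p ⟨.exec q v, m, lists T, o⟩
      (P.ofCfg m o (TM2.stepAux q v T)) := by
  induction q generalizing v T with
  | push i f q ih =>
    have h := ih v (Function.update T i (f v :: T i))
    rw [← update_lists] at h
    refine .head (.head ?_)
    simpa [StackMachine.step, toStackMachine, next, apply_only, lists_def] using h
  | peek i f q ih =>
    refine .head ?_
    simpa [StackMachine.step, toStackMachine, next, headI_lists] using ih _ T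
  | pop i f q ih =>
    have h := ih (f v (T i).head?) (Function.update T i (T i).tail)
    rw [← update_lists] at h
    refine .head ?_
    simpa [StackMachine.step, toStackMachine, next, headI_map_some, apply_only,
      lists_def, List.map_tail] using h
  | load f q ih =>
    refine .head ?_
    simpa [StackMachine.step, toStackMachine, next] using ih (f v) T
  | branch f q₁ q₂ ih₁ ih₂ =>
    refine .head ?_
    simp only [StackMachine.step, toStackMachine, next, TM2.stepAux, cond_false,
      Option.toList_none, List.append_nil]
    cases f v
    · exact ih₂ v T
    · exact ih₁ v T
  | goto f => exact .of_step_eq (by simp [StackMachine.step, toStackMachine, next, ofCfg])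
  | halt => exact .of_step_eq (by simp [StackMachine.step, toStackMachine, next, ofCfg])

theorem reaches_ofCfg (m : ℕ) (o : List A) {c c' : TM2.Cfg (fun _ : K' => Γ') P.Λ P.σ}
    (h : StateTransition.Reaches (TM2.step P.tr) c c') :
    P.toStackMachine.Reaches p (P.ofCfg m o c) (P.ofCfg m o c') := by
  induction h with
  | refl => exact .refl _
  | @tail c _ _ h ih =>
    obtain ⟨_ | l, v, T⟩ := c
    · cases h
    · cases h
      exact ih.trans (reaches_stepAux m o _ v T)

theorem reaches_post (m : ℕ) (o : List A) (T : K' → List Γ') {w rest : List Γ'}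
    (hw : ∀ x ∈ w, natEnd x = false) (l : List Γ') (hl : (l ++ w).length ≤ P.bound) :
    P.toStackMachine.Reaches p
      ⟨.post l, m, lists (Function.update T .main (w ++ Γ'.cons :: rest)), o⟩
      ⟨.read, m, lists (Function.update T .main rest), o ++ (P.dec (l ++ w)).toList⟩ := by
  induction w generalizing l with
  | nil =>
    exact .of_step_eq (by
      simp [StackMachine.step, toStackMachine, next, apply_only, ← update_lists])
  | cons x w ih =>
    have h := ih (fun y hy => hw y (List.mem_cons_of_mem _ hy)) (l ++ [x]) (by simpa using hl)
    have hx : natEnd x = false := hw x List.mem_cons_self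
    have hlt : l.length < P.bound := by
      simp only [List.length_append, List.length_cons] at hl
      omega
    refine .head ?_
    simpa [StackMachine.step, toStackMachine, next, headI_lists, apply_only, hx, hlt,
      ← update_lists, -natEnd] using h

theorem reaches_start : P.toStackMachine.Reaches p P.toStackMachine.init
    ⟨.read, 0, lists (K'.elim [Γ'.cons] [] [] []), []⟩ := by
  have h : Function.update (fun _ => []) K'.main [some Γ'.cons] =
      lists (K'.elim [Γ'.cons] [] [] []) := by
    funext i
    cases i <;> rfl
  exact .of_step_eq (by
    simp [StackMachine.init, StackMachine.step, toStackMachine, next, apply_only, ← h])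

end StackLoop

end StackLoop

/-! ## Evaluation of primitive recursive functions in a loop -/

section CodeLoop

open Turing Turing.PartrecToTM2

theorem trPosNum_ne_nil (n : PosNum) : trPosNum n ≠ [] := by
  cases n <;> simp [trPosNum]

theorem trPosNum_injective : Function.Injective trPosNum := by
  intro a
  induction a with
  | one => rintro (_ | b | b) h <;> simp_all [trPosNum, (trPosNum_ne_nil _).symm]
  | bit1 a ih =>
    rintro (_ | b | b) h
    · simp [trPosNum, trPosNum_ne_nil] at h
    · simp only [trPosNum, List.cons.injEq, true_and] at h
      rw [ih h]
    · simp [trPosNum] at h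
  | bit0 a ih =>
    rintro (_ | b | b) h
    · simp [trPosNum] at h
    · simp [trPosNum] at h
    · simp only [trPosNum, List.cons.injEq, true_and] at h
      rw [ih h]

theorem trNum_injective : Function.Injective trNum := by
  rintro (_ | x) (_ | y) h
  · rfl
  · exact absurd h.symm (trPosNum_ne_nil y)
  · exact absurd h (trPosNum_ne_nil x)
  · exact congrArg _ (trPosNum_injective h)

theorem trNat_injective : Function.Injective trNat :=
  trNum_injective.comp Nat.cast_injective

theorem exists_code_primrec₂ {α β γ : Type*} [Primcodable α] [Primcodable β] [Primcodable γ]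
    {f : α → β → γ} (hf : Primrec₂ f) : ∃ c : ToPartrec.Code, ∀ a b,
      c.eval [Encodable.encode a, Encodable.encode b] = pure [Encodable.encode (f a b)] := by
  -- `encode (some x) = encode x + 1`
  have hpred := Primrec.pred.comp₂ (Primrec.encode.comp₂ (Primrec₂.nat_iff'.1 hf))
  obtain ⟨c, hc⟩ := ToPartrec.Code.exists_code
    (Nat.Partrec'.prim (Nat.Primrec'.prim_iff₂.2 hpred))
  refine ⟨c, fun a b => ?_⟩
  simpa using! hc (Encodable.encode a ::ᵥ Encodable.encode b ::ᵥ .nil)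

theorem exists_code_primrec₂_pair {α β γ δ : Type*} [Primcodable α] [Primcodable β] [Primcodable γ]
    [Primcodable δ] {f : α → β → γ} {g : α → β → δ} (hf : Primrec₂ f) (hg : Primrec₂ g) :
    ∃ c : ToPartrec.Code, ∀ a b, c.eval [Encodable.encode a, Encodable.encode b] =
      pure [Encodable.encode (f a b), Encodable.encode (g a b)] := by
  obtain ⟨c, hc⟩ := exists_code_primrec₂ hf
  obtain ⟨d, hd⟩ := exists_code_primrec₂ hg
  exact ⟨.cons c d, fun a b => by simp [hc, hd]⟩

theorem reaches_halt_of_eval_eq {c : ToPartrec.Code} {v w : List ℕ} (h : c.eval v = pure w) :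
    StateTransition.Reaches (TM2.step tr) (PartrecToTM2.init c v) (PartrecToTM2.halt w) := by
  refine (StateTransition.mem_eval.1 ?_).1
  rw [tr_eval, h]
  exact Part.mem_map _ (Part.mem_some w)

/-- Push `l` on the main stack. -/
def pushAll {Λ σ : Type} : List Γ' → StackStmt Λ σ → StackStmt Λ σ
  | [], q => q
  | x :: l, q => pushAll l (.push .main (fun _ => x) q)

theorem stepAux_pushAll {Λ σ : Type} (l : List Γ') (q : StackStmt Λ σ) (v : σ)
    (T : K' → List Γ') : TM2.stepAux (pushAll l q) v T =
      TM2.stepAux q v (Function.update T .main (l ++ T .main)) := by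
  induction l generalizing q with
  | nil => simp [pushAll]
  | cons x l ih => simp [pushAll, ih]

theorem supportsStmt_pushAll {Λ σ : Type} {S : Finset Λ} (l : List Γ') {q : StackStmt Λ σ}
    (h : TM2.SupportsStmt S q) : TM2.SupportsStmt S (pushAll l q) := by
  induction l generalizing q with
  | nil => exact h
  | cons _ _ ih => exact ih h

variable {A : Type u} {k : ℕ} [Encodable A]

/-- The loop that evaluates `c` in each round, at the code of the column of input symbols and a
number that is kept on the main stack between the rounds. -/
noncomputable def codeLoop (c : ToPartrec.Code) (code : (Fin k → A) → ℕ) (bound : ℕ) :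
    StackLoop A k where
  Λ := Λ'
  σ := Option Γ'
  tr := tr
  load a := pushAll (trNat (code a) ++ [Γ'.cons]) (.goto fun _ => trNormal c Cont'.halt)
  v₀ := none
  dec := Function.invFun fun o : Option A => trNat (Encodable.encode o)
  bound := bound
  support := codeSupp c Cont'.halt
  support_tr := (tr_supports c Cont'.halt).2
  support_load _ := supportsStmt_pushAll _ fun _ => (tr_supports c Cont'.halt).1

namespace codeLoop

variable {c : ToPartrec.Code} {code : (Fin k → A) → ℕ} {bound : ℕ}

theorem stepAux_load (a : Fin k → A) (s : ℕ) :
    TM2.stepAux ((codeLoop c code bound).load a) none (K'.elim (trList [s]) [] [] []) =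
      PartrecToTM2.init c [code a, s] := by
  simp only [codeLoop]
  rw [stepAux_pushAll, K'.elim_update_main]
  simp [PartrecToTM2.init, trList]

theorem dec_trNat_encode (o : Option A) :
    (codeLoop c code bound).dec (trNat (Encodable.encode o)) = o :=
  Function.leftInverse_invFun (f := fun o : Option A => trNat (Encodable.encode o))
    (trNat_injective.comp Encodable.encode_injective) o

variable (c code bound) in
/-- The configuration at the beginning of the round `m`, where `s` is the number on the main stack
and `o` is the output. -/
def roundConfig (m s : ℕ) (o : List A) : (codeLoop c code bound).toStackMachine.Config :=
  ⟨.read, m, StackLoop.lists (K'.elim (trList [s]) [] [] []), o⟩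

theorem reaches_roundConfig_zero (p : Fin k → OmegaWord A) :
    (codeLoop c code bound).toStackMachine.Reaches p
      (codeLoop c code bound).toStackMachine.init (roundConfig c code bound 0 0 []) := by
  simpa [roundConfig, trList] using StackLoop.reaches_start (P := codeLoop c code bound) (p := p)

theorem reaches_roundConfig_succ
    {p : Fin k → OmegaWord A} {m s s' : ℕ} {o : Option A}
    (ho : (trNat (Encodable.encode o)).length ≤ bound)
    (hc : c.eval [code fun i => p i m, s] = pure [Encodable.encode o, s']) (out : List A) :
    (codeLoop c code bound).toStackMachine.Reaches p (roundConfig c code bound m s out)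
      (roundConfig c code bound (m + 1) s' (out ++ o.toList)) := by
  have hload := StackLoop.reaches_stepAux (P := codeLoop c code bound) (p := p) (m + 1) out
    ((codeLoop c code bound).load fun i => p i m) none (K'.elim (trList [s]) [] [] [])
  rw [stepAux_load] at hload
  have heval := StackLoop.reaches_ofCfg (P := codeLoop c code bound) (p := p) (m + 1) out
    (reaches_halt_of_eval_eq hc)
  have hpost := StackLoop.reaches_post (P := codeLoop c code bound) (p := p) (m + 1) out
    (K'.elim (trList [Encodable.encode o, s']) [] [] []) (rest := trList [s'])
    (trNat_natEnd _) [] ho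
  rw [K'.elim_update_main, K'.elim_update_main, List.nil_append, dec_trNat_encode] at hpost
  refine .head ?_
  simp only [StackMachine.step, roundConfig, StackLoop.toStackMachine, StackLoop.next,
    StackOp.apply_nop, cond_true, Option.toList_none, List.append_nil]
  exact (hload.trans heval).trans hpost

end codeLoop

end CodeLoop

/-! ## Primitive recursive transducers -/

section Transducer

open ApproxRel

variable {A : Type u} {k : ℕ}

/-- A tuple of sequences as a sequence of columns. -/
def columns (p : Fin k → OmegaWord A) : OmegaWord (Fin k → A) := fun j i => p i j

theorem map_take_columns (p : Fin k → OmegaWord A) (m : ℕ) (i : Fin k) :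
    ((columns p).take m).map (· i) = (p i).take m :=
  List.map_ofFn

/-- A transducer reads one column of input symbols in each round, and then writes at most one output
symbol, which depends on the columns and the output so far. -/
abbrev Transducer (A : Type u) (k : ℕ) := List (Fin k → A) → List A → Option A

namespace Transducer

/-- The output of the transducer in the first `m` rounds. -/
def output (T : Transducer A k) (p : Fin k → OmegaWord A) : ℕ → List A
  | 0 => []
  | m + 1 => output T p m ++ (T ((columns p).take (m + 1)) (output T p m)).toList

theorem monotone_length_output (T : Transducer A k) (p : Fin k → OmegaWord A) :
    Monotone fun m => (T.output p m).length :=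
  monotone_nat_of_le_succ fun m => by simp [output]

theorem exists_machine [Primcodable A] [Finite A] {T : Transducer A k} (hT : Primrec₂ T) :
    ∃ M : TypeTwoMachine A k, ∀ p, (∀ n, ∃ κ, M.run p n = some κ) ∧
      ∀ m, ∃ n κ, M.run p n = some κ ∧ κ.out = T.output p m := by
  let symbol (a : Fin k → A) (s : List (Fin k → A) × List A) : Option A := T (s.1 ++ [a]) s.2
  let next (a : Fin k → A) (s : List (Fin k → A) × List A) : List (Fin k → A) × List A :=
    (s.1 ++ [a], s.2 ++ (symbol a s).toList)
  have hcolumns : Primrec₂ fun (a : Fin k → A) (s : List (Fin k → A) × List A) => s.1 ++ [a] :=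
    Primrec.list_concat.comp (Primrec.fst.comp Primrec.snd) Primrec.fst
  have hsymbol : Primrec₂ symbol := hT.comp hcolumns (Primrec.snd.comp Primrec.snd)
  have hnext : Primrec₂ next := Primrec.pair hcolumns
    (Primrec.list_append.comp (Primrec.snd.comp Primrec.snd) (Primrec.optionToList.comp hsymbol))
  obtain ⟨c, hc⟩ := exists_code_primrec₂_pair hsymbol hnext
  obtain ⟨bound, hbound⟩ := (Set.finite_range fun o : Option A =>
    (Turing.PartrecToTM2.trNat (Encodable.encode o)).length).bddAbove
  let P := codeLoop c (Primcodable.toEncodable.encode : (Fin k → A) → ℕ) bound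
  obtain ⟨M, hM⟩ := StackMachine.exists_typeTwoMachine P.finite_states P.start_mem_states
    P.next_mem_states
  refine ⟨M, fun p => ⟨(hM p).1, fun m => ?_⟩⟩
  refine (hM p).2 (codeLoop.roundConfig _ _ _ m
    (Primcodable.toEncodable.encode ((columns p).take m, T.output p m)) (T.output p m)) ?_
  induction m with
  | zero => exact codeLoop.reaches_roundConfig_zero p
  | succ m ih =>
    refine ih.trans (codeLoop.reaches_roundConfig_succ (hbound ⟨_, rfl⟩) ((hc _ _).trans ?_) _)
    simp only [next, symbol, OmegaWord.take_succ, output]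
    rfl

/-- The transducer that in each round evaluates `Φ` at the prefixes that have been read, and writes
the next symbol if `Φ` yields it. -/
def ofRealizer (Φ : ℕ → (Fin k → List A) → List A) : Transducer A k := fun cols out =>
  (Φ cols.length fun i => cols.map (· i))[out.length]?

variable {F : MultiFun (Fin k → OmegaWord A) (OmegaWord A)} {Φ : ℕ → (Fin k → List A) → List A}
  {p : Fin k → OmegaWord A} {q : OmegaWord A}

theorem ofRealizer_take_columns (p : Fin k → OmegaWord A) (m : ℕ) (out : List A) :
    ofRealizer Φ ((columns p).take m) out = (Φ m fun i => (p i).take m)[out.length]? := by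
  simp only [ofRealizer, OmegaWord.length_take, map_take_columns]

theorem isPrefix_output_ofRealizer (h : Realizes (word A).tuple (word A) F Φ) (hq : q ∈ F p)
    (m : ℕ) : IsPrefix ((ofRealizer Φ).output p m) q := by
  induction m with
  | zero => exact isPrefix_nil q
  | succ m ih =>
    refine ih.append_toList fun a ha => ?_
    rw [ofRealizer_take_columns] at ha
    exact word_zero_iff.1 (h.sound p q hq _ _ (tuple_word_zero_take p _)) _ a ha

theorem exists_le_length_output_ofRealizer (h : Realizes (word A).tuple (word A) F Φ)
    (hq : q ∈ F p) (j : ℕ) : ∃ m, j ≤ ((ofRealizer Φ).output p m).length := by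
  induction j with
  | zero => exact ⟨0, Nat.zero_le _⟩
  | succ j ih =>
    obtain ⟨m, hm⟩ := ih
    obtain ⟨n, hn⟩ := (h.complete p q hq (j + 1)).exists
    have hj := hm.trans (monotone_length_output _ p (le_max_left m n))
    rcases hj.lt_or_eq with hlt | heq
    · exact ⟨_, hlt⟩
    · refine ⟨max m n + 1, ?_⟩
      have hle : n ≤ max m n + 1 := (le_max_right m n).trans (Nat.le_succ _)
      have hΦ := (hn (max m n + 1) hle (fun i => (p i).take (max m n + 1)) fun i =>
        ⟨isPrefix_take _ _, hle.trans_eq (OmegaWord.length_take _ _).symm⟩).2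
      replace heq : ((ofRealizer Φ).output p (max m n)).length = j := heq.symm
      rw [output, ofRealizer_take_columns, heq, List.getElem?_eq_getElem hΦ]
      simp [heq]

theorem primrec₂_ofRealizer [Primcodable A] (hΦ : Primrec₂ Φ) : Primrec₂ (ofRealizer Φ) :=
  Primrec.list_getElem?.comp
    (hΦ.comp (Primrec.list_length.comp Primrec.fst) (primrec_pi_mk fun i =>
      Primrec.list_map Primrec.fst (primrec_pi_apply Primrec.snd i).to₂))
    (Primrec.list_length.comp Primrec.snd)

end Transducer

variable [Primcodable A] [Finite A] {Φ : ℕ → (Fin k → List A) → List A}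

theorem Realizes.exists_machine {F : MultiFun (Fin k → OmegaWord A) (OmegaWord A)}
    (h : Realizes (word A).tuple (word A) F Φ) (hΦ : Primrec₂ Φ) :
    ∃ M : TypeTwoMachine A k, ∀ p, ∀ q ∈ F p, M.OutputsSeq p q := by
  obtain ⟨M, hM⟩ := Transducer.exists_machine (Transducer.primrec₂_ofRealizer hΦ)
  refine ⟨M, fun p q hq => ⟨(hM p).1, fun j => ?_⟩⟩
  obtain ⟨m, hm⟩ := Transducer.exists_le_length_output_ofRealizer h hq (j + 1)
  obtain ⟨n, κ, hκ, hout⟩ := (hM p).2 m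
  exact ⟨n, κ, hκ, hout ▸ (Transducer.isPrefix_output_ofRealizer h hq m).getElem?_eq hm⟩

theorem Realizes.computableSeq {g : (Fin k → OmegaWord A) →. OmegaWord A}
    (h : Realizes (word A).tuple (word A) (MultiFun.ofPFun g) Φ) (hΦ : Primrec₂ Φ) :
    ComputableSeq g := by
  obtain ⟨M, hM⟩ := h.exists_machine hΦ
  obtain ⟨f, hf⟩ := MultiFun.exists_eq_ofPFun (F := fun p => {q | M.OutputsSeq p q})
    fun p q hq q' hq' => TypeTwoMachine.OutputsSeq.unique hq hq'
  have hf' (p q) : q ∈ f p ↔ M.OutputsSeq p q := (Set.ext_iff.1 (congrFun hf p) q).symm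
  exact ⟨f, ⟨M, hf'⟩, fun p q hq => (hf' p q).2 (hM p q hq)⟩

end Transducer

theorem theoremt3_general {A : Type*} [Zero A] [One A] [NeZero (1 : A)] {k L : ℕ}
    (N : GTM A k L (fun _ => OmegaWord A)) :
    ((∀ l, (N.stm l).IsContinuous) →
      ∃ g : (Fin k → OmegaWord A) →. OmegaWord A,
        N.multiFun = MultiFun.ofPFun g ∧ PFunContinuous g) ∧
    (Finite A → (∀ l, (N.stm l).IsComputable) →
      ∃ g : (Fin k → OmegaWord A) →. OmegaWord A,
        N.multiFun = MultiFun.ofPFun g ∧ ComputableSeq g) := by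
  refine ⟨fun h => ?_, fun _ h => ?_⟩
  · choose E hE using fun l => N.exists_realizesEffect_of_isContinuous (h l)
    have hN := N.realizes_symRun hE
    obtain ⟨g, hg⟩ := MultiFun.exists_eq_ofPFun hN.subsingleton
    exact ⟨g, hg, (hg ▸ hN).pfunContinuous⟩
  · let := primcodableOfFinite A
    let := primcodableOfFinite N.Γ
    let := primcodableOfFinite N.Label
    choose E hE hE' using fun l => N.exists_realizesEffect_of_isComputable (h l)
    have hN := N.realizes_symRun hE
    obtain ⟨g, hg⟩ := MultiFun.exists_eq_ofPFun hN.subsingleton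
    exact ⟨g, hg, (hg ▸ hN).computableSeq (N.primrec₂_symRun hE')⟩

end TTE

theorem theoremt3 {A : Type*} [Finite A] [Zero A] [One A] [NeZero (1 : A)] {k L : ℕ}
    (N : TTE.GTM A k L (fun _ => TTE.OmegaWord A)) :
    ((∀ l, (N.stm l).IsContinuous) →
      ∃ g : (Fin k → TTE.OmegaWord A) →. TTE.OmegaWord A,
        N.multiFun = TTE.MultiFun.ofPFun g ∧ TTE.PFunContinuous g) ∧
    ((∀ l, (N.stm l).IsComputable) →
      ∃ g : (Fin k → TTE.OmegaWord A) →. TTE.OmegaWord A,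
        N.multiFun = TTE.MultiFun.ofPFun g ∧ TTE.ComputableSeq g) :=
  (TTE.theoremt3_general N).imp_right fun h => h inferInstance
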